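/- Let $R$ be a commutative ring in which $2$ is invertible and let $X=\operatorname{Spec}R$. Quasi-coherent sheaves on $X$ are identified with $R$-modules, and vector bundles (locally free sheaves of finite rank) with finitely generated projective $R$-modules. **Definitions.** For a finite length complex $A^\bullet$ of vector bundles, the dual complex $(A^\bullet)^\vee=A_\bullet$ has the term $(A^{-i})^\vee$ in degree $i$, and its differentials are the duals of those of $A^\bullet$, without signs. A *quadratic complex* $(\mathbb E,\theta)$ on $X$ is a perfect complex $\mathbb E\in D_{\mathrm{QCoh}}(X)$ with an isomorphism $\theta:\mathbb E\to\mathbb E^\vee$ to its derived dual such that $\theta^\vee=\theta$ under $\mathbb E\simeq\mathbb E^{\vee\vee}$. A morphism of complexes $t:A^\bullet\to A_\bullet$ is *self-dual* if $t^\vee=t$ under $A^\bullet\simeq (A_\bullet)^\vee$; it *represents* $\theta$ under an isomorphism $\beta:A^\bullet\to\mathbb E$ in $D_{\mathrm{QCoh}}(X)$ if $\beta^\vee\circ\theta\circ\beta=[t]$. A *self-dual representative* of $\mathbb E$ is a finite length complex $E^\bullet$ of vector bundles with a self-dual isomorphism of complexes $\theta_E:E^\bullet\to E_\bullet$ and an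 isomorphism $\alpha_E:E^\bullet\to\mathbb E$ in $D_{\mathrm{QCoh}}(X)$ under which $\theta_E$ represents $\theta$. The *splicing* of a morphism of complexes $f:A^\bullet\to B^\bullet$ is the complex $$A_f^\bullet=[\cdots\to B^{-2}\to B^{-1}\xrightarrow{(d,0)}A_f^0\xrightarrow{\mathrm{pr}_2}A^1\to A^2\to\cdots],\qquad A_f^0=\{(b,a)\in B^0\oplus A^1: db=f_1(a),\ da=0\},$$ with the morphisms $\eta^-(f):A^\bullet\to A_f^\bullet$ (equal to $f_i$ for $i<0$, to $(f_0,d)$ for $i=0$ and to the identity for $i>0$) and $\eta^+(f):A_f^\bullet\to B^\bullet$ (equal to the identity for $i<0$, to $\mathrm{pr}_1$ for $i=0$ and to $f_i$ for $i>0$). A *generalized isotropic reduction* from $E^\bullet$ to $F^\bullet$, written $F^\bullet\rightsquigarrow E^\bullet$, for self-dual representatives $E^\bullet,F^\bullet$ of $\mathbb E$, consists of a finite length complex $A^\bullet$ of vector bundles and quasi-isomorphisms of complexes $F^\bullet\xleftarrow{f}A^\bullet\xrightarrow{e}E^\bullet$ with $\alpha_F\circ[f]=\alpha_E\circ[e]$,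 such that $f_i$ is an isomorphism for $i\ge1$, $e_i$ is an isomorphism for $i\le-1$, and $f^\vee\circ\theta_F\circ f=e^\vee\circ\theta_E\circ e$. It is an *isotropic reduction* (a *genuine* one) if moreover $(e_1,d):A^1\to E^1\oplus A^2$ is an inclusion of vector bundles, i.e. has a surjective dual. **Theorem.** Let $(\mathbb E,\theta)$ be a quadratic complex on $X$. 1. There are a finite length complex $A^\bullet$ of vector bundles, a self-dual morphism of complexes $t:A^\bullet\to A_\bullet$ and an isomorphism $\beta:A^\bullet\to\mathbb E$ in $D_{\mathrm{QCoh}}(X)$ under which $t$ represents $\theta$. 2. For any such $(A^\bullet,t,\beta)$, the splicing $A_t^\bullet$ is a finite length complex of vector bundles and underlies a self-dual representative $(A_t^\bullet,\theta',\alpha)$ of $\mathbb E$ with $\alpha\circ[\eta^-(t)]=\beta$ and $\eta^-(t)^\vee\circ\theta'=\eta^+(t)$. In particular, self-dual representatives of $\mathbb E$ exist. 3. If $F^\bullet\rightsquigarrow E^\bullet$ is a generalized isotropic reduction between self-dual representatives of $\mathbb E$, there are a self-dual representative $E'^\bullet$ of $\mathbb E$ and genuine isotropic reductions $E^\bullet\rightsquigarrow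 E'^\bullet$ and $F^\bullet\rightsquigarrow E'^\bullet$. 4. For any two self-dual representatives $E^\bullet,F^\bullet$ of $\mathbb E$ there are a self-dual representative $G^\bullet$ of $\mathbb E$ with generalized isotropic reductions $G^\bullet\rightsquigarrow F^\bullet$ and $G^\bullet\rightsquigarrow E^\bullet$, and self-dual representatives $E'^\bullet,F'^\bullet$ of $\mathbb E$ with genuine isotropic reductions $$E^\bullet\rightsquigarrow E'^\bullet,\qquad G^\bullet\rightsquigarrow E'^\bullet,\qquad G^\bullet\rightsquigarrow F'^\bullet,\qquad F^\bullet\rightsquigarrow F'^\bullet,$$ so that $E^\bullet$ and $F^\bullet$ are connected by a zigzag of genuine isotropic reductions. -/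

import Mathlib

open CategoryTheory

universe w u

namespace QuadCplx

/-! ### Complexes of modules and the strict dual

Quasi-coherent sheaves on the affine scheme `Spec R` are `R`-modules, and locally free sheaves of
finite rank are finitely generated projective `R`-modules. -/

/-- Cochain complexes of `R`-modules. -/
abbrev Cplx (R : Type u) [CommRing R] := CochainComplex (ModuleCat.{u} R) ℤ

/-- Finite length complexes of vector bundles on `Spec R`. -/
structure IsVectorBundleComplex {R : Type u} [CommRing R] (A : Cplx R) : Prop where
  bounded : ∃ a b : ℤ, ∀ i : ℤ, i < a ∨ b < i → Subsingleton (A.X i)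
  finite : ∀ i : ℤ, Module.Finite R (A.X i)
  projective : ∀ i : ℤ, Module.Projective R (A.X i)

/-- The dual module. -/
abbrev dualObj {R : Type u} [CommRing R] (M : ModuleCat.{u} R) : ModuleCat.{u} R :=
  ModuleCat.of R (Module.Dual R M)

/-- The dual of a linear map. -/
def dualHom {R : Type u} [CommRing R] {M N : ModuleCat.{u} R} (f : M ⟶ N) :
    dualObj N ⟶ dualObj M :=
  ModuleCat.ofHom f.hom.dualMap

theorem dualHom_comp {R : Type u} [CommRing R] {M N P : ModuleCat.{u} R} (f : M ⟶ N) (g : N ⟶ P) :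
    dualHom (f ≫ g) = dualHom g ≫ dualHom f := rfl

theorem dualHom_zero {R : Type u} [CommRing R] {M N : ModuleCat.{u} R} :
    dualHom (0 : M ⟶ N) = 0 := by
  ext x y
  exact map_zero x

theorem dualHom_add {R : Type u} [CommRing R] {M N : ModuleCat.{u} R} (f g : M ⟶ N) :
    dualHom (f + g) = dualHom f + dualHom g := by
  ext x y
  exact map_add x _ _

/-- The dual complex, with terms `(A⁻ⁱ)ᵛ` in degree `i` and with the dual differentials,
without any signs. -/
def dual {R : Type u} [CommRing R] (A : Cplx R) : Cplx R where
  X i := dualObj (A.X (-i))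
  d i j := dualHom (A.d (-j) (-i))
  shape i j h := by
    rw [A.shape (-j) (-i), dualHom_zero]
    intro h'
    apply h
    simp only [ComplexShape.up_Rel] at h' ⊢
    omega
  d_comp_d' i j k _ _ := by
    rw [← dualHom_comp, A.d_comp_d, dualHom_zero]

/-- The dual of a morphism of complexes. -/
def dualMap {R : Type u} [CommRing R] {A B : Cplx R} (f : A ⟶ B) : dual B ⟶ dual A where
  f i := dualHom (f.f (-i))
  comm' i j _ := by
    change dualHom _ ≫ dualHom _ = dualHom _ ≫ dualHom _
    rw [← dualHom_comp, ← dualHom_comp, f.comm]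

/-- The evaluation map from a module to its double dual. -/
def evHom {R : Type u} [CommRing R] (M : ModuleCat.{u} R) : M ⟶ dualObj (dualObj M) :=
  ModuleCat.ofHom (Module.Dual.eval R M)

theorem evHom_comp {R : Type u} [CommRing R] {M N : ModuleCat.{u} R} (f : M ⟶ N) :
    evHom M ≫ dualHom (dualHom f) = f ≫ evHom N := rfl

/-- The evaluation morphism from a complex to its double dual. -/
def ev {R : Type u} [CommRing R] (A : Cplx R) : A ⟶ dual (dual A) where
  f i := (A.XIsoOfEq (neg_neg i).symm).hom ≫ evHom (A.X (- -i))
  comm' i j _ := by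
    change (_ ≫ _) ≫ dualHom (dualHom (A.d (- -i) (- -j))) = _
    rw [Category.assoc, evHom_comp, HomologicalComplex.XIsoOfEq_hom_comp_d_assoc,
      ← HomologicalComplex.d_comp_XIsoOfEq_hom A (neg_neg j).symm i, Category.assoc]
    rfl

@[simp]
theorem dualMap_id {R : Type u} [CommRing R] (A : Cplx R) : dualMap (𝟙 A) = 𝟙 (dual A) := by
  ext i x
  rfl

theorem dualMap_comp {R : Type u} [CommRing R] {A B C : Cplx R} (f : A ⟶ B) (g : B ⟶ C) :
    dualMap (f ≫ g) = dualMap g ≫ dualMap f := by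
  ext i x
  rfl

/-- A morphism `θ : A ⟶ Aᵛ` is self-dual if `θᵛ = θ` under the identification of `A` with its
double dual. -/
def IsSelfDual {R : Type u} [CommRing R] {A : Cplx R} (θ : A ⟶ dual A) : Prop :=
  ev A ≫ dualMap θ = θ

theorem IsVectorBundleComplex.dual {R : Type u} [CommRing R] {A : Cplx R}
    (hA : IsVectorBundleComplex A) : IsVectorBundleComplex (dual A) where
  bounded := by
    obtain ⟨a, b, h⟩ := hA.bounded
    refine ⟨-b, -a, fun i hi => ?_⟩
    have : Subsingleton (A.X (-i)) := h (-i) (by omega)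
    exact inferInstanceAs (Subsingleton (Module.Dual R (A.X (-i))))
  finite i := by
    have := hA.finite (-i)
    have := hA.projective (-i)
    exact inferInstanceAs (Module.Finite R (Module.Dual R (A.X (-i))))
  projective i := by
    have := hA.finite (-i)
    have := hA.projective (-i)
    exact inferInstanceAs (Module.Projective R (Module.Dual R (A.X (-i))))

/-- Chain homotopies can be dualized. -/
def dualHomotopy {R : Type u} [CommRing R] {A B : Cplx R} {f g : A ⟶ B} (h : Homotopy f g) :
    Homotopy (dualMap f) (dualMap g) where
  hom i j := dualHom (h.hom (-j) (-i))
  zero i j hij := by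
    have h0 : h.hom (-j) (-i) = 0 := h.zero _ _ (by
      intro h'
      apply hij
      simp only [ComplexShape.up_Rel] at h' ⊢
      omega)
    rw [h0, dualHom_zero]
    rfl
  comm i := by
    have hc := h.comm (-i)
    rw [dNext_eq h.hom (show (ComplexShape.up ℤ).Rel (-i) (-(i - 1)) by
        simp only [ComplexShape.up_Rel]; omega),
      prevD_eq h.hom (show (ComplexShape.up ℤ).Rel (-(i + 1)) (-i) by
        simp only [ComplexShape.up_Rel]; omega)] at hc
    let k : ∀ i j : ℤ, (dual B).X i ⟶ (dual A).X j := fun i j => dualHom (h.hom (-j) (-i))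
    have h1 := dNext_eq k (show (ComplexShape.up ℤ).Rel i (i + 1) by simp)
    have h2 := prevD_eq k (show (ComplexShape.up ℤ).Rel (i - 1) i by simp)
    change _ = dNext i k + prevD i k + _
    rw [h1, h2, add_comm ((dual B).d i (i + 1) ≫ k (i + 1) i)]
    have hc' := congrArg dualHom hc
    rw [dualHom_add, dualHom_add] at hc'
    exact hc'

/-! ### Perfect complexes and the derived dual -/

/-- Objects of the derived category which are represented by a finite length complex of vector
bundles. -/
def IsPerfect {R : Type u} [CommRing R] [HasDerivedCategory.{w} (ModuleCat.{u} R)]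
    (E : DerivedCategory (ModuleCat.{u} R)) : Prop :=
  ∃ P : Cplx R, IsVectorBundleComplex P ∧ Nonempty (DerivedCategory.Q.obj P ≅ E)

/-- A representative of an object of the derived category by a finite length complex of vector
bundles. -/
structure Model {R : Type u} [CommRing R] [HasDerivedCategory.{w} (ModuleCat.{u} R)]
    (E : DerivedCategory (ModuleCat.{u} R)) where
  cplx : Cplx R
  isVB : IsVectorBundleComplex cplx
  iso : DerivedCategory.Q.obj cplx ≅ E

/-- A finite length complex of vector bundles represents itself. -/
noncomputable abbrev Model.self {R : Type u} [CommRing R] [HasDerivedCategory.{w} (ModuleCat.{u} R)]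
    (P : Cplx R) (hP : IsVectorBundleComplex P) :
    Model (R := R) (DerivedCategory.Q.obj P) where
  cplx := P
  isVB := hP
  iso := Iso.refl _

/-- Finite length complexes of vector bundles are K-projective. -/
theorem IsVectorBundleComplex.isKProjective {R : Type u} [CommRing R] {P : Cplx R}
    (hP : IsVectorBundleComplex P) : P.IsKProjective := by
  obtain ⟨a, b, h⟩ := hP.bounded
  have : P.IsStrictlyLE b := by
    rw [CochainComplex.isStrictlyLE_iff]
    intro i hi
    have := h i (Or.inr hi)
    exact ModuleCat.isZero_of_subsingleton _
  have (n : ℤ) : Projective (P.X n) := by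
    have := hP.projective n
    exact (IsProjective.iff_projective (R := R) (P.X n)).1 this
  exact CochainComplex.isKProjective_of_projective P b

/-- Morphisms in the derived category between finite length complexes of vector bundles are
represented by morphisms of complexes. -/
theorem exists_lift {R : Type u} [CommRing R] [HasDerivedCategory.{w} (ModuleCat.{u} R)]
    {P : Cplx R} (hP : IsVectorBundleComplex P) {L : Cplx R}
    (f : DerivedCategory.Q.obj P ⟶ DerivedCategory.Q.obj L) :
    ∃ φ : P ⟶ L, DerivedCategory.Q.map φ = f := by
  have := hP.isKProjective
  obtain ⟨g, hg⟩ := (CochainComplex.IsKProjective.Qh_map_bijective P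
    ((HomotopyCategory.quotient _ _).obj L)).surjective
      ((DerivedCategory.quotientCompQhIso _).hom.app P ≫ f ≫
        (DerivedCategory.quotientCompQhIso _).inv.app L)
  obtain ⟨φ, rfl⟩ := (HomotopyCategory.quotient _ _).map_surjective g
  refine ⟨φ, ?_⟩
  have h1 := DerivedCategory.quotientCompQhIso_hom_naturality φ
  rw [hg] at h1
  simp only [Category.assoc, Iso.inv_hom_id_app, Category.comp_id] at h1
  exact ((cancel_epi _).1 h1).symm

/-- Two such representatives differ by a chain homotopy. -/
theorem homotopy_of_map_eq {R : Type u} [CommRing R] [HasDerivedCategory.{w} (ModuleCat.{u} R)]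
    {P : Cplx R} (hP : IsVectorBundleComplex P) {L : Cplx R} {φ ψ : P ⟶ L}
    (h : DerivedCategory.Q.map φ = DerivedCategory.Q.map ψ) : Nonempty (Homotopy φ ψ) := by
  have := hP.isKProjective
  refine ⟨HomotopyCategory.homotopyOfEq _ _ ?_⟩
  refine (CochainComplex.IsKProjective.Qh_map_bijective P
    ((HomotopyCategory.quotient _ _).obj L)).injective ?_
  have h1 := DerivedCategory.quotientCompQhIso_hom_naturality φ
  have h2 := DerivedCategory.quotientCompQhIso_hom_naturality ψ
  rw [h, ← h2] at h1
  exact (cancel_mono _).1 h1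

theorem map_eq_of_homotopy {R : Type u} [CommRing R] [HasDerivedCategory.{w} (ModuleCat.{u} R)]
    {P L : Cplx R} {φ ψ : P ⟶ L} (h : Homotopy φ ψ) :
    DerivedCategory.Q.map φ = DerivedCategory.Q.map ψ := by
  have h0 := HomotopyCategory.eq_of_homotopy φ ψ h
  have h1 := DerivedCategory.quotientCompQhIso_hom_naturality φ
  have h2 := DerivedCategory.quotientCompQhIso_hom_naturality ψ
  rw [h0, h2] at h1
  exact ((cancel_epi _).1 h1).symm

/-- The derived dual of a morphism `f : E ⟶ F`, computed on models of `E` and `F`: dualize a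
morphism of complexes which represents `f`. -/
noncomputable def derivedTranspose {R : Type u} [CommRing R]
    [HasDerivedCategory.{w} (ModuleCat.{u} R)]
    {E F : DerivedCategory (ModuleCat.{u} R)} (p : Model E) (q : Model F) (f : E ⟶ F) :
    DerivedCategory.Q.obj (dual q.cplx) ⟶ DerivedCategory.Q.obj (dual p.cplx) :=
  DerivedCategory.Q.map (dualMap (exists_lift p.isVB (p.iso.hom ≫ f ≫ q.iso.inv)).choose)

/-- The derived dual of a morphism does not depend on the morphism of complexes representing
it. -/
theorem derivedTranspose_eq {R : Type u} [CommRing R] [HasDerivedCategory.{w} (ModuleCat.{u} R)]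
    {E F : DerivedCategory (ModuleCat.{u} R)} (p : Model E) (q : Model F) (f : E ⟶ F)
    (φ : p.cplx ⟶ q.cplx) (h : DerivedCategory.Q.map φ = p.iso.hom ≫ f ≫ q.iso.inv) :
    derivedTranspose p q f = DerivedCategory.Q.map (dualMap φ) := by
  have hs := (exists_lift p.isVB (p.iso.hom ≫ f ≫ q.iso.inv)).choose_spec
  obtain ⟨H⟩ := homotopy_of_map_eq p.isVB (hs.trans h.symm)
  exact map_eq_of_homotopy (dualHomotopy H)

theorem derivedTranspose_id {R : Type u} [CommRing R] [HasDerivedCategory.{w} (ModuleCat.{u} R)]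
    {E : DerivedCategory (ModuleCat.{u} R)} (p : Model E) :
    derivedTranspose p p (𝟙 E) = 𝟙 _ := by
  rw [derivedTranspose_eq p p (𝟙 E) (𝟙 _) (by simp)]
  simp

theorem derivedTranspose_comp {R : Type u} [CommRing R]
    [HasDerivedCategory.{w} (ModuleCat.{u} R)]
    {E F G : DerivedCategory (ModuleCat.{u} R)} (p : Model E) (q : Model F) (r : Model G)
    (f : E ⟶ F) (g : F ⟶ G) :
    derivedTranspose p r (f ≫ g) = derivedTranspose q r g ≫ derivedTranspose p q f := by
  obtain ⟨φ, hφ⟩ := exists_lift p.isVB (p.iso.hom ≫ f ≫ q.iso.inv)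
  obtain ⟨ψ, hψ⟩ := exists_lift q.isVB (q.iso.hom ≫ g ≫ r.iso.inv)
  rw [derivedTranspose_eq p q f φ hφ, derivedTranspose_eq q r g ψ hψ,
    derivedTranspose_eq p r (f ≫ g) (φ ≫ ψ) (by simp [hφ, hψ]), dualMap_comp,
    Functor.map_comp]

/-- A chosen model of a perfect complex. -/
noncomputable def IsPerfect.model {R : Type u} [CommRing R]
    [HasDerivedCategory.{w} (ModuleCat.{u} R)]
    {E : DerivedCategory (ModuleCat.{u} R)} (hE : IsPerfect E) : Model E where
  cplx := hE.choose
  isVB := hE.choose_spec.1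
  iso := hE.choose_spec.2.some

/-- The dual of a perfect complex in the derived category. By functoriality of
`derivedTranspose`, another model yields a canonically isomorphic object. -/
noncomputable abbrev derivedDual {R : Type u} [CommRing R]
    [HasDerivedCategory.{w} (ModuleCat.{u} R)]
    {E : DerivedCategory (ModuleCat.{u} R)} (hE : IsPerfect E) :
    DerivedCategory (ModuleCat.{u} R) :=
  DerivedCategory.Q.obj (dual hE.model.cplx)

theorem isPerfect_derivedDual {R : Type u} [CommRing R]
    [HasDerivedCategory.{w} (ModuleCat.{u} R)]
    {E : DerivedCategory (ModuleCat.{u} R)} (hE : IsPerfect E) : IsPerfect (derivedDual hE) :=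
  ⟨dual hE.model.cplx, hE.model.isVB.dual, ⟨Iso.refl _⟩⟩

/-- The dual `fᵛ : Fᵛ ⟶ Eᵛ` of a morphism `f : E ⟶ F` of perfect complexes. -/
noncomputable def derivedDualMap {R : Type u} [CommRing R]
    [HasDerivedCategory.{w} (ModuleCat.{u} R)]
    {E F : DerivedCategory (ModuleCat.{u} R)} (hE : IsPerfect E) (hF : IsPerfect F) (f : E ⟶ F) :
    derivedDual hF ⟶ derivedDual hE :=
  derivedTranspose hE.model hF.model f

/-- The biduality morphism `E ⟶ Eᵛᵛ` of a perfect complex: evaluation on the model of `E`, followed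
by the canonical identification of the duals of the two models at hand of `Eᵛ`. -/
noncomputable def biduality {R : Type u} [CommRing R]
    [HasDerivedCategory.{w} (ModuleCat.{u} R)]
    {E : DerivedCategory (ModuleCat.{u} R)} (hE : IsPerfect E) :
    E ⟶ derivedDual (isPerfect_derivedDual hE) :=
  hE.model.iso.inv ≫ DerivedCategory.Q.map (ev hE.model.cplx) ≫
    derivedTranspose (isPerfect_derivedDual hE).model
      (Model.self (dual hE.model.cplx) hE.model.isVB.dual) (𝟙 (derivedDual hE))

/-- The dual `αᵛ : Eᵛ ⟶ Cᵛ` of a morphism `α : C ⟶ E` in the derived category, where `C` is a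
finite length complex of vector bundles, whose derived dual is identified with its dual complex. -/
noncomputable def dualOfRepresentation {R : Type u} [CommRing R]
    [HasDerivedCategory.{w} (ModuleCat.{u} R)]
    {E : DerivedCategory (ModuleCat.{u} R)} (hE : IsPerfect E)
    {C : Cplx R} (hC : IsVectorBundleComplex C) (α : DerivedCategory.Q.obj C ⟶ E) :
    derivedDual hE ⟶ DerivedCategory.Q.obj (dual C) :=
  derivedTranspose (Model.self C hC) hE.model α

/-- A quadratic complex on `Spec R`: a perfect complex `E` with an isomorphism `θ : E ≅ Eᵛ` such
that `θᵛ = θ`. -/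
structure QuadraticComplex (R : Type u) [CommRing R]
    [HasDerivedCategory.{w} (ModuleCat.{u} R)] where
  obj : DerivedCategory (ModuleCat.{u} R)
  isPerfect : IsPerfect obj
  θ : obj ≅ derivedDual isPerfect
  self_dual : biduality isPerfect ≫ derivedDualMap isPerfect (isPerfect_derivedDual isPerfect) θ.hom
    = θ.hom

/-- A morphism of complexes `t : C ⟶ Cᵛ` represents the form of a quadratic complex `E` under
`α : C ≅ E` if `θ` is the composition of `α⁻¹`, `t` and `(αᵛ)⁻¹`. -/
def Represents {R : Type u} [CommRing R] [HasDerivedCategory.{w} (ModuleCat.{u} R)]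
    (E : QuadraticComplex.{w} R) {C : Cplx R} (hC : IsVectorBundleComplex C) (t : C ⟶ dual C)
    (α : DerivedCategory.Q.obj C ≅ E.obj) : Prop :=
  α.hom ≫ E.θ.hom ≫ dualOfRepresentation E.isPerfect hC α.hom = DerivedCategory.Q.map t

/-! ### Self-dual representatives -/

/-- The structure of a self-dual representative of `E` on a complex `C`: `C` is a finite length
complex of vector bundles, it carries a self-dual isomorphism of complexes with its dual, and it
is identified with `E` in the derived category compatibly with the forms. -/
structure SelfDualRepStructure {R : Type u} [CommRing R]
    [HasDerivedCategory.{w} (ModuleCat.{u} R)] (E : QuadraticComplex.{w} R) (C : Cplx R) where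
  isVB : IsVectorBundleComplex C
  θ : C ≅ dual C
  self_dual : IsSelfDual θ.hom
  α : DerivedCategory.Q.obj C ≅ E.obj
  represents : Represents E isVB θ.hom α

/-- A self-dual representative of a quadratic complex. -/
structure SelfDualRep {R : Type u} [CommRing R]
    [HasDerivedCategory.{w} (ModuleCat.{u} R)] (E : QuadraticComplex.{w} R) where
  cplx : Cplx R
  str : SelfDualRepStructure E cplx

/-! ### Splicing -/

/-- The map `c₁ : B⁰ ⊕ A¹ ⟶ B¹ ⊕ A²` given by `(b, a) ↦ (d b - f₁ a, d a)`. -/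
def spliceC1 {R : Type u} [CommRing R] {A B : Cplx R} (f : A ⟶ B) :
    (B.X 0 × A.X 1) →ₗ[R] (B.X 1 × A.X 2) :=
  ((B.d 0 1).hom.coprod (-(f.f 1).hom)).prod ((A.d 1 2).hom ∘ₗ LinearMap.snd R (B.X 0) (A.X 1))

/-- The terms of the spliced complex: those of `B` in negative degrees, the kernel of `c₁` in degree
zero, and those of `A` in positive degrees. -/
def spliceX {R : Type u} [CommRing R] {A B : Cplx R} (f : A ⟶ B) : ℤ → ModuleCat.{u} R
  | Int.ofNat 0 => ModuleCat.of R (LinearMap.ker (spliceC1 f))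
  | Int.ofNat (n + 1) => A.X (Int.ofNat (n + 1))
  | Int.negSucc n => B.X (Int.negSucc n)

/-- The map `B⁻¹ ⟶ ker c₁`, `b ↦ (d b, 0)`. -/
def spliceIn {R : Type u} [CommRing R] {A B : Cplx R} (f : A ⟶ B) :
    B.X (-1) →ₗ[R] LinearMap.ker (spliceC1 f) :=
  LinearMap.codRestrict _ (LinearMap.prod (B.d (-1) 0).hom 0) (by
    intro b
    have h : (B.d 0 1).hom ((B.d (-1) 0).hom b) = 0 := by
      rw [← LinearMap.comp_apply, ← ModuleCat.hom_comp, B.d_comp_d]; rfl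
    simp [spliceC1, h])

/-- The map `ker c₁ ⟶ A¹`, `(b, a) ↦ a`. -/
def spliceOut {R : Type u} [CommRing R] {A B : Cplx R} (f : A ⟶ B) :
    LinearMap.ker (spliceC1 f) →ₗ[R] A.X 1 :=
  LinearMap.snd R (B.X 0) (A.X 1) ∘ₗ Submodule.subtype _

/-- The differentials of the spliced complex. -/
def spliceD {R : Type u} [CommRing R] {A B : Cplx R} (f : A ⟶ B) :
    ∀ i : ℤ, spliceX f i ⟶ spliceX f (i + 1)
  | Int.ofNat 0 => ModuleCat.ofHom (spliceOut f)
  | Int.ofNat (n + 1) => A.d (Int.ofNat (n + 1)) (Int.ofNat (n + 2))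
  | Int.negSucc 0 => ModuleCat.ofHom (spliceIn f)
  | Int.negSucc (n + 1) => B.d (Int.negSucc (n + 1)) (Int.negSucc n)

theorem spliceD_comp {R : Type u} [CommRing R] {A B : Cplx R} (f : A ⟶ B) :
    ∀ i : ℤ, spliceD f i ≫ spliceD f (i + 1) = 0
  | Int.ofNat 0 => by
    ext x
    have hx : spliceC1 f x.1 = 0 := x.2
    exact congrArg Prod.snd hx
  | Int.ofNat (n + 1) => A.d_comp_d _ _ _
  | Int.negSucc 0 => by
    ext x
    rfl
  | Int.negSucc 1 => by
    ext x
    refine Subtype.ext (Prod.ext ?_ rfl)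
    have h := B.d_comp_d (-2) (-1) 0
    exact congrArg (fun t => t.hom x) h
  | Int.negSucc (n + 2) => B.d_comp_d _ _ _

/-- The splicing `… ⟶ B⁻² ⟶ B⁻¹ ⟶ ker c₁ ⟶ A¹ ⟶ A² ⟶ …` of `f : A ⟶ B`. -/
def splice {R : Type u} [CommRing R] {A B : Cplx R} (f : A ⟶ B) : Cplx R :=
  CochainComplex.of (spliceX f) (spliceD f) (spliceD_comp f)

/-- The map `A⁰ ⟶ ker c₁`, `a ↦ (f₀ a, d a)`. -/
def spliceZero {R : Type u} [CommRing R] {A B : Cplx R} (f : A ⟶ B) :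
    A.X 0 →ₗ[R] LinearMap.ker (spliceC1 f) :=
  LinearMap.codRestrict _ (LinearMap.prod (f.f 0).hom (A.d 0 1).hom) (by
    intro a
    have h1 : (A.d 1 2).hom ((A.d 0 1).hom a) = 0 := by
      rw [← LinearMap.comp_apply, ← ModuleCat.hom_comp, A.d_comp_d]; rfl
    have h2 : (B.d 0 1).hom ((f.f 0).hom a) = (f.f 1).hom ((A.d 0 1).hom a) := by
      rw [← LinearMap.comp_apply, ← LinearMap.comp_apply, ← ModuleCat.hom_comp,
        ← ModuleCat.hom_comp, f.comm]
    simp [spliceC1, h1, h2])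

/-- The components of the morphism `A ⟶ splice f`. -/
def etaMinusF {R : Type u} [CommRing R] {A B : Cplx R} (f : A ⟶ B) :
    ∀ i : ℤ, A.X i ⟶ spliceX f i
  | Int.ofNat 0 => ModuleCat.ofHom (spliceZero f)
  | Int.ofNat (n + 1) => 𝟙 (A.X (Int.ofNat (n + 1)))
  | Int.negSucc n => f.f (Int.negSucc n)

/-- The components of the morphism `splice f ⟶ B`. -/
def etaPlusF {R : Type u} [CommRing R] {A B : Cplx R} (f : A ⟶ B) :
    ∀ i : ℤ, spliceX f i ⟶ B.X i
  | Int.ofNat 0 =>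
    ModuleCat.ofHom (LinearMap.fst R (B.X 0) (A.X 1) ∘ₗ (LinearMap.ker (spliceC1 f)).subtype)
  | Int.ofNat (n + 1) => f.f (Int.ofNat (n + 1))
  | Int.negSucc n => 𝟙 (B.X (Int.negSucc n))

theorem etaMinusF_comm {R : Type u} [CommRing R] {A B : Cplx R} (f : A ⟶ B) :
    ∀ i : ℤ, etaMinusF f i ≫ spliceD f i = A.d i (i + 1) ≫ etaMinusF f (i + 1)
  | Int.ofNat 0 => by
    ext x
    rfl
  | Int.ofNat (n + 1) => (Category.id_comp _).trans (Category.comp_id _).symm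
  | Int.negSucc 0 => by
    ext x
    refine Subtype.ext (Prod.ext ?_ ?_)
    · exact congrArg (fun t => t.hom x) (f.comm (Int.negSucc 0) 0)
    · exact (congrArg (fun t => t.hom x) (A.d_comp_d (Int.negSucc 0) 0 1)).symm
  | Int.negSucc (n + 1) => f.comm _ _

theorem etaPlusF_comm {R : Type u} [CommRing R] {A B : Cplx R} (f : A ⟶ B) :
    ∀ i : ℤ, etaPlusF f i ≫ B.d i (i + 1) = spliceD f i ≫ etaPlusF f (i + 1)
  | Int.ofNat 0 => by
    ext x
    have hx : spliceC1 f x.1 = 0 := x.2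
    have h1 : (B.d 0 1).hom x.1.1 + -(f.f 1).hom x.1.2 = 0 := congrArg Prod.fst hx
    exact (eq_neg_of_add_eq_zero_left h1).trans (neg_neg _)
  | Int.ofNat (n + 1) => f.comm _ _
  | Int.negSucc 0 => by
    ext x
    rfl
  | Int.negSucc (n + 1) => (Category.id_comp _).trans (Category.comp_id _).symm

/-- The morphism `η⁻(f) : A ⟶ splice f`. -/
def etaMinus {R : Type u} [CommRing R] {A B : Cplx R} (f : A ⟶ B) : A ⟶ splice f where
  f i := etaMinusF f i
  comm' i j hij := by
    obtain rfl : i + 1 = j := hij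
    have h := CochainComplex.of_d (spliceX f) (spliceD f) i
    exact (congrArg (fun t => etaMinusF f i ≫ t) h).trans (etaMinusF_comm f i)

/-- The morphism `η⁺(f) : splice f ⟶ B`. -/
def etaPlus {R : Type u} [CommRing R] {A B : Cplx R} (f : A ⟶ B) : splice f ⟶ B where
  f i := etaPlusF f i
  comm' i j hij := by
    obtain rfl : i + 1 = j := hij
    have h := CochainComplex.of_d (spliceX f) (spliceD f) i
    exact (etaPlusF_comm f i).trans (congrArg (fun t => t ≫ etaPlusF f (i + 1)) h.symm)

/-! ### Isotropic reductions -/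

/-- A generalized isotropic reduction from `F` to `G`, that is, `G ⇜ A ⟶ F`: quasi-isomorphisms
`g : A ⟶ G` and `f : A ⟶ F`, compatible with the identifications with `E`, such that `g` is an
isomorphism in degrees `≥ 1`, `f` is an isomorphism in degrees `≤ -1`, and the two forms induced
on `A` agree. -/
structure GenIsotropicReduction {R : Type u} [CommRing R]
    [HasDerivedCategory.{w} (ModuleCat.{u} R)] {E : QuadraticComplex.{w} R}
    (F G : SelfDualRep E) where
  A : Cplx R
  isVB : IsVectorBundleComplex A
  g : A ⟶ G.cplx
  f : A ⟶ F.cplx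
  quasiIso_g : QuasiIso g
  quasiIso_f : QuasiIso f
  compatible : DerivedCategory.Q.map g ≫ G.str.α.hom = DerivedCategory.Q.map f ≫ F.str.α.hom
  isIso_g : ∀ i : ℤ, 1 ≤ i → IsIso (g.f i)
  isIso_f : ∀ i : ℤ, i ≤ -1 → IsIso (f.f i)
  forms : g ≫ G.str.θ.hom ≫ dualMap g = f ≫ F.str.θ.hom ≫ dualMap f

/-- An isotropic reduction from `F` to `G`: in addition, `(f₁, d) : A¹ ⟶ F¹ ⊕ A²` is an inclusion
of vector bundles, i.e. it has a surjective dual. -/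
structure IsotropicReduction {R : Type u} [CommRing R]
    [HasDerivedCategory.{w} (ModuleCat.{u} R)] {E : QuadraticComplex.{w} R}
    (F G : SelfDualRep E) extends GenIsotropicReduction F G where
  inclusion : Function.Surjective ((f.f 1).hom.prod (A.d 1 2).hom).dualMap

end QuadCplx

/-! Call a quasi-isomorphism of type P if it is an isomorphism in degrees ≥ 1, and of type N if it
is one in degrees ≤ -1. Splicing factors every quasi-isomorphism as type P followed by type N, and
type P lifts uniquely against type N (`exists_square_lift`, `lift_unique`): for `p : S' ⟶ B` of type
N, the term `S'⁰` is the module of pairs `(b, s)` with `d b = p s` and `d s = 0`. Dualizing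
exchanges the two types. Hence a self-dual `t = η⁺ η⁻` has a second factorization, the transposed
one; unique lifting between the two gives an isomorphism from the spliced complex to its dual and
forces it to be self-dual (`exists_selfDual_iso`). Such a `t` exists because the form lifts to a
model by projectivity and, as 2 is invertible, can be averaged with its transpose.

A generalized reduction `F ⟵ A ⟶ G` need not be split injective in degree one. Enlarging `F` to `F ⊕
Cone(id_A)`, pulling the form back and splicing gives a representative into which both `F` and `A`
map with split monomorphisms in degree one, and `nonempty_isotropicReduction` turns each of these
maps into a genuine reduction.

Any two representatives are related by a single generalized reduction
(`nonempty_genIsotropicReduction`). Splice a map `G ⟶ F` compatible with the identifications and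
invert the type P half up to homotopy. On the resulting `F ⟵ A ⟶ G` the two forms are homotopic
through a symmetric pairing, and `exists_homotopic_forms_eq` absorbs this pairing into the two legs
without disturbing the degrees in which they must be isomorphisms. -/

namespace QuadCplx

/-! ### Quasi-isomorphisms and cycles of the mapping cone, by elements -/

section Elements

variable {R : Type u} [CommRing R] {A B C : Cplx R}

theorem d_d_apply (A : Cplx R) (i j k : ℤ) (x : A.X i) :
    (A.d j k).hom ((A.d i j).hom x) = 0 := by
  rw [← LinearMap.comp_apply, ← ModuleCat.hom_comp, A.d_comp_d]; rfl

theorem comm_apply (f : A ⟶ B) (i j : ℤ) (x : A.X i) :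
    (B.d i j).hom ((f.f i).hom x) = (f.f j).hom ((A.d i j).hom x) := by
  rw [← LinearMap.comp_apply, ← LinearMap.comp_apply, ← ModuleCat.hom_comp,
    ← ModuleCat.hom_comp, f.comm]

/-- The mapping cone of `f` is exact, in terms of elements. -/
def ConeExact (f : A ⟶ B) : Prop :=
  ∀ i j k l : ℤ, i + 1 = j → j + 1 = k → k + 1 = l → ∀ (a : A.X k) (b : B.X j),
    (A.d k l).hom a = 0 → (B.d j k).hom b = (f.f k).hom a →
      ∃ (a' : A.X j) (b' : B.X i), (A.d j k).hom a' = a ∧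
        (f.f j).hom a' + (B.d i j).hom b' = b

theorem exists_of_refinement {M M' : ModuleCat.{u} R} (π : M' ⟶ M) [Epi π] (x : M) :
    ∃ x' : M', π.hom x' = x :=
  (ModuleCat.epi_iff_surjective π).1 inferInstance x

/-- The map from `R` with a given value at `1`. -/
abbrev elt (M : ModuleCat.{u} R) (x : M) : ModuleCat.of R R ⟶ M :=
  ModuleCat.ofHom (LinearMap.toSpanSingleton R M x)

/-- A family of elements defines a map from a free module. -/
noncomputable abbrev freeElt {S : Type u} (M : ModuleCat.{u} R) (x : S → M) : ModuleCat.of R (S →₀ R) ⟶ M :=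
  ModuleCat.ofHom (Finsupp.linearCombination R x)

theorem freeElt_ext {S : Type u} {M : ModuleCat.{u} R} {f g : ModuleCat.of R (S →₀ R) ⟶ M}
    (h : ∀ s, f.hom (Finsupp.single s 1) = g.hom (Finsupp.single s 1)) : f = g := by
  refine ModuleCat.hom_ext (Finsupp.lhom_ext' fun s => LinearMap.ext_ring ?_)
  exact h s

theorem freeElt_single {S : Type u} (M : ModuleCat.{u} R) (x : S → M) (s : S) :
    (freeElt M x).hom (Finsupp.single s 1) = x s := by
  simp [freeElt]

instance epi_freeElt_id (M : ModuleCat.{u} R) : Epi (freeElt M (id : M → M)) :=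
  (ModuleCat.epi_iff_surjective _).2 fun x => ⟨Finsupp.single x 1, freeElt_single M id x⟩

theorem elt_comp {M N : ModuleCat.{u} R} (x : M) (f : M ⟶ N) :
    elt M x ≫ f = elt N (f.hom x) := by
  refine ModuleCat.hom_ext (LinearMap.ext_ring ?_)
  simp [elt]

theorem elt_zero (M : ModuleCat.{u} R) : elt M (0 : M) = 0 := by
  refine ModuleCat.hom_ext (LinearMap.ext_ring ?_)
  simp [elt]

theorem prev_up {i j : ℤ} (h : i + 1 = j) : (ComplexShape.up ℤ).prev j = i :=
  (ComplexShape.up ℤ).prev_eq' h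

theorem next_up {i j : ℤ} (h : i + 1 = j) : (ComplexShape.up ℤ).next i = j :=
  (ComplexShape.up ℤ).next_eq' h

theorem eq_d_of_quasiIso (f : A ⟶ B) [QuasiIso f] {i j k : ℤ} (hij : i + 1 = j) (hjk : j + 1 = k)
    (a : A.X j) (b : B.X i) (ha : (A.d j k).hom a = 0) (h : (f.f j).hom a = (B.d i j).hom b) :
    ∃ a' : A.X i, (A.d i j).hom a' = a := by
  have hm : Mono (HomologicalComplex.homologyMap f j) := inferInstance
  rw [HomologicalComplex.mono_homologyMap_iff_up_to_refinements f i j k (prev_up hij)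
    (next_up hjk)] at hm
  obtain ⟨M, π, _, x, hx⟩ := hm (elt _ a) (by rw [elt_comp, ha, elt_zero]) (elt _ b)
    (by rw [elt_comp, elt_comp, h])
  obtain ⟨s, hs⟩ := exists_of_refinement π (1 : R)
  refine ⟨x.hom s, ?_⟩
  have h1 := congrArg (fun t => t.hom s) hx
  have h2 : (elt (A.X j) a).hom (π.hom s) = (A.d i j).hom (x.hom s) := h1
  rw [← h2, hs]
  simp [elt]

theorem exists_cocycle_of_quasiIso (f : A ⟶ B) [QuasiIso f] {i j k : ℤ} (hij : i + 1 = j)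
    (hjk : j + 1 = k) (b : B.X j) (hb : (B.d j k).hom b = 0) :
    ∃ (a : A.X j) (b' : B.X i), (A.d j k).hom a = 0 ∧
      (f.f j).hom a + (B.d i j).hom b' = b := by
  have hm : Epi (HomologicalComplex.homologyMap f j) := inferInstance
  rw [HomologicalComplex.epi_homologyMap_iff_up_to_refinements f i j k (prev_up hij)
    (next_up hjk)] at hm
  obtain ⟨M, π, _, x, hx, y, hy⟩ := hm (elt _ b) (by rw [elt_comp, hb, elt_zero])
  obtain ⟨s, hs⟩ := exists_of_refinement π (1 : R)
  refine ⟨x.hom s, y.hom s, congrArg (fun t => t.hom s) hx, ?_⟩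
  have h2 : (elt (B.X j) b).hom (π.hom s) = (f.f j).hom (x.hom s) + (B.d i j).hom (y.hom s) :=
    congrArg (fun t => t.hom s) hy
  rw [← h2, hs]
  simp [elt]

/-- Injectivity on cohomology writes `a` as `d a₁`; then `b - f a₁` is a cocycle, and surjectivity
corrects `a₁` by a cocycle. -/
theorem coneExact_of_quasiIso (f : A ⟶ B) [QuasiIso f] : ConeExact f := by
  intro i j k l hij hjk hkl a b ha hb
  obtain ⟨a₁, ha₁⟩ := eq_d_of_quasiIso f hjk hkl a b ha hb.symm
  obtain ⟨a₂, b', ha₂, h⟩ := exists_cocycle_of_quasiIso f hij hjk (b - (f.f j).hom a₁)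
    (by rw [map_sub, comm_apply, ha₁, hb, sub_self])
  refine ⟨a₁ + a₂, b', by rw [map_add, ha₁, ha₂, add_zero], ?_⟩
  rw [map_add, add_assoc, h, add_sub_cancel]

/-- Exactness at a pair whose `a` is an arbitrary cocycle gives injectivity on cohomology; exactness
at pairs with `a = 0` gives surjectivity. -/
theorem ConeExact.quasiIso {f : A ⟶ B} (hf : ConeExact f) : QuasiIso f := by
  rw [quasiIso_iff]
  intro j
  rw [quasiIsoAt_iff_isIso_homologyMap]
  have hmono : Mono (HomologicalComplex.homologyMap f j) := by
    rw [HomologicalComplex.mono_homologyMap_iff_up_to_refinements f (j - 1) j (j + 1)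
      (prev_up (by omega)) (next_up rfl)]
    intro M x hx y hy
    have key : ∀ s : M, ∃ a' : A.X (j - 1), (A.d (j - 1) j).hom a' = x.hom s := by
      intro s
      obtain ⟨a', _, h, _⟩ := hf (j - 1 - 1) (j - 1) j (j + 1) (by omega) (by omega) rfl (x.hom s)
        (y.hom s) (congrArg (fun t => t.hom s) hx) (congrArg (fun t => t.hom s) hy.symm)
      exact ⟨a', h⟩
    choose g hg using key
    -- The chosen preimages need not depend linearly on `s`. Covering `M` by the free module on its
    -- elements turns the choice into a morphism.
    refine ⟨_, freeElt M id, inferInstance, freeElt _ g, freeElt_ext fun s => ?_⟩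
    rw [ModuleCat.hom_comp, ModuleCat.hom_comp, LinearMap.comp_apply, LinearMap.comp_apply,
      freeElt_single, freeElt_single, hg]
    rfl
  have hepi : Epi (HomologicalComplex.homologyMap f j) := by
    rw [HomologicalComplex.epi_homologyMap_iff_up_to_refinements f (j - 1) j (j + 1)
      (prev_up (by omega)) (next_up rfl)]
    intro M y hy
    have key : ∀ s : M, ∃ (a' : A.X j) (b' : B.X (j - 1)), (A.d j (j + 1)).hom a' = 0 ∧
        (f.f j).hom a' + (B.d (j - 1) j).hom b' = y.hom s := by
      intro s
      exact hf (j - 1) j (j + 1) (j + 1 + 1) (by omega) rfl rfl 0 (y.hom s)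
        (map_zero _) ((congrArg (fun t => t.hom s) hy).trans (map_zero _).symm)
    choose g g' hg hg' using key
    refine ⟨_, freeElt M id, inferInstance, freeElt _ g, freeElt_ext fun s => ?_, freeElt _ g',
      freeElt_ext fun s => ?_⟩
    · rw [ModuleCat.hom_comp, LinearMap.comp_apply, freeElt_single, hg]
      rfl
    · rw [ModuleCat.hom_comp, LinearMap.comp_apply, freeElt_single, ModuleCat.hom_add,
        LinearMap.add_apply, ModuleCat.hom_comp, ModuleCat.hom_comp, LinearMap.comp_apply,
        LinearMap.comp_apply, freeElt_single, freeElt_single, hg']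
      rfl
  exact isIso_of_mono_of_epi _

/-- The differential `(b, a) ↦ (d b - f a, d a)` of the mapping cone. -/
def coneD (f : A ⟶ B) (i j k : ℤ) : (B.X i × A.X j) →ₗ[R] (B.X j × A.X k) :=
  ((B.d i j).hom.coprod (-(f.f j).hom)).prod ((A.d j k).hom ∘ₗ LinearMap.snd R (B.X i) (A.X j))

theorem mem_ker_coneD (f : A ⟶ B) (i j k : ℤ) (x : B.X i × A.X j) :
    x ∈ LinearMap.ker (coneD f i j k) ↔
      (B.d i j).hom x.1 = (f.f j).hom x.2 ∧ (A.d j k).hom x.2 = 0 := by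
  rw [LinearMap.mem_ker, Prod.ext_iff]
  refine and_congr ?_ Iff.rfl
  change (B.d i j).hom x.1 + -(f.f j).hom x.2 = 0 ↔ _
  rw [← sub_eq_add_neg, sub_eq_zero]

/-- For a quasi-isomorphism of finite length complexes of vector bundles, the cycles of the mapping
cone are direct summands. -/
theorem exists_retraction_ker_coneD {f : A ⟶ B} (hf : ConeExact f)
    (hA : IsVectorBundleComplex A) (hB : IsVectorBundleComplex B) (i j k : ℤ)
    (hij : i + 1 = j) (hjk : j + 1 = k) :
    ∃ r : (B.X i × A.X j) →ₗ[R] LinearMap.ker (coneD f i j k), ∀ x, r x.1 = x := by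
  obtain ⟨_, a, ha⟩ := hA.bounded
  obtain ⟨_, b, hb⟩ := hB.bounded
  suffices H : ∀ (n : ℕ) (i j k : ℤ), i + 1 = j → j + 1 = k → max a b < i + n →
      ∃ r : (B.X i × A.X j) →ₗ[R] LinearMap.ker (coneD f i j k), ∀ x, r x.1 = x from
    H (max a b + 1 - i).toNat i j k hij hjk (by omega)
  -- Descending induction on the degree: the cone is exact and vanishes in high degrees, so each
  -- surjection onto the next module of cycles splits once those cycles are projective.
  intro n
  induction n with
  | zero =>
    intro i j k hij hjk hn
    have := hB.bounded
    have h1 : Subsingleton (A.X j) := ha j (by right; omega)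
    have h2 : Subsingleton (B.X i) := hb i (by right; omega)
    exact ⟨0, fun x => Subsingleton.elim _ _⟩
  | succ n ih =>
    intro i j k hij hjk hn
    obtain ⟨r, hr⟩ := ih j k (k + 1) hjk rfl (by omega)
    have := hA.projective
    have := hB.projective
    have hproj : Module.Projective R (LinearMap.ker (coneD f j k (k + 1))) :=
      Module.Projective.of_split (Submodule.subtype _) r (LinearMap.ext hr)
    -- The second component carries a sign that `coneD` lacks. With it the values are cycles for the
    -- next `coneD`, and the kernel is unchanged.
    let D : (B.X i × A.X j) →ₗ[R] LinearMap.ker (coneD f j k (k + 1)) :=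
      (((B.d i j).hom.coprod (-(f.f j).hom)).prod
        (-((A.d j k).hom ∘ₗ LinearMap.snd R (B.X i) (A.X j)))).codRestrict _ (fun x => by
        rw [mem_ker_coneD]
        change (B.d j k).hom ((B.d i j).hom x.1 + -(f.f j).hom x.2) =
          (f.f k).hom (-(A.d j k).hom x.2) ∧ (A.d k (k + 1)).hom (-(A.d j k).hom x.2) = 0
        simp only [map_neg, map_add, d_d_apply, comm_apply, zero_add, neg_zero, and_true])
    have hD : Function.Surjective D := by
      rintro ⟨⟨y, x⟩, hx⟩
      have hx' := (mem_ker_coneD f j k (k + 1) _).1 hx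
      obtain ⟨a', b', h1, h2⟩ := hf i j k (k + 1) hij hjk rfl x y hx'.2 hx'.1
      refine ⟨(b', -a'), Subtype.ext (Prod.ext ?_ ?_)⟩
      · change (B.d i j).hom b' + -(f.f j).hom (-a') = y
        rw [map_neg, neg_neg, ← h2, add_comm]
      · change -(A.d j k).hom (-a') = x
        rw [map_neg, neg_neg, h1]
    have hDk : ∀ x : B.X i × A.X j, x ∈ LinearMap.ker (coneD f i j k) ↔ D x = 0 := fun x => by
      rw [mem_ker_coneD, Subtype.ext_iff, Prod.ext_iff]
      change _ ↔ (B.d i j).hom x.1 + -(f.f j).hom x.2 = 0 ∧ -(A.d j k).hom x.2 = 0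
      rw [← sub_eq_add_neg, sub_eq_zero, neg_eq_zero]
    obtain ⟨s, hs⟩ := Module.projective_lifting_property D LinearMap.id hD
    refine ⟨(LinearMap.id - s ∘ₗ D).codRestrict _ (fun x => ?_), fun x => Subtype.ext ?_⟩
    · have : D x = 0 := (hDk x).1 x.2
      change (x : B.X i × A.X j) - s (D x) = x
      rw [this, map_zero, sub_zero]
    · rw [hDk]
      have := LinearMap.congr_fun hs (D x)
      rw [LinearMap.comp_apply, LinearMap.id_apply] at this
      rw [LinearMap.sub_apply, LinearMap.id_apply, LinearMap.comp_apply, map_sub, this, sub_self]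

end Elements

/-! ### Splicing as a factorization of quasi-isomorphisms -/

section Splicing

variable {R : Type u} [CommRing R] {A B : Cplx R}

theorem splice_d (f : A ⟶ B) (i : ℤ) : (splice f).d i (i + 1) = spliceD f i :=
  CochainComplex.of_d _ _ i

theorem etaMinus_comp_etaPlus (f : A ⟶ B) : etaMinus f ≫ etaPlus f = f := by
  refine HomologicalComplex.hom_ext _ _ fun i => ?_
  match i with
  | Int.ofNat 0 => rfl
  | Int.ofNat (n + 1) => exact Category.id_comp _
  | Int.negSucc n => exact Category.comp_id _

theorem isIso_etaMinus_f (f : A ⟶ B) (i : ℤ) (hi : 1 ≤ i) : IsIso ((etaMinus f).f i) := by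
  match i, hi with
  | Int.ofNat (n + 1), _ => exact inferInstanceAs (IsIso (𝟙 (A.X (Int.ofNat (n + 1)))))

theorem isIso_etaPlus_f (f : A ⟶ B) (i : ℤ) (hi : i ≤ -1) : IsIso ((etaPlus f).f i) := by
  match i, hi with
  | Int.negSucc n, _ => exact inferInstanceAs (IsIso (𝟙 (B.X (Int.negSucc n))))
  | Int.ofNat n, h => exact absurd h (by simp; omega)

/-- In negative degrees this is exactness of the cone of `f`. An element of the spliced term in
degree zero is itself a cone cycle of `f`, so exactness for `f` applies there too. -/
theorem coneExact_etaMinusF {f : A ⟶ B} (hf : ConeExact f) :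
    ∀ (i : ℤ) (a : A.X (i + 1 + 1)) (b : spliceX f (i + 1)),
      (A.d (i + 1 + 1) (i + 1 + 1 + 1)).hom a = 0 →
      (spliceD f (i + 1)).hom b = (etaMinusF f (i + 1 + 1)).hom a →
      ∃ (a' : A.X (i + 1)) (b' : spliceX f i), (A.d (i + 1) (i + 1 + 1)).hom a' = a ∧
        (etaMinusF f (i + 1)).hom a' + (spliceD f i).hom b' = b
  -- Here `i + 1 ≥ 1`, where `η⁻` is the identity, so `b` itself serves as the preimage.
  | Int.ofNat n => fun a b _ hb =>
    ⟨b, 0, hb, (congrArg _ (map_zero (spliceD f (Int.ofNat n)).hom)).trans (add_zero _)⟩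
  | Int.negSucc 0 => fun a b ha hb => by
    have hb' := (mem_ker_coneD f 0 1 2 b.1).1 b.2
    obtain ⟨a', b', h1, h2⟩ := hf (-1) 0 1 2 rfl rfl rfl b.1.2 b.1.1 hb'.2 hb'.1
    refine ⟨a', b', h1.trans hb, Subtype.ext (Prod.ext h2 ?_)⟩
    change (A.d 0 1).hom a' + 0 = _
    rw [add_zero, h1]
  | Int.negSucc 1 => fun a b ha hb => by
    have hb' : (B.d (-1) 0).hom b = (f.f 0).hom a := congrArg (fun t => t.1.1) hb
    exact hf (Int.negSucc 1) (Int.negSucc 0) 0 1 rfl rfl rfl a b ha hb'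
  | Int.negSucc (n + 2) => fun a b ha hb => hf _ _ _ _ rfl rfl rfl a b ha hb

theorem quasiIso_etaMinus (f : A ⟶ B) [QuasiIso f] : QuasiIso (etaMinus f) := by
  refine ConeExact.quasiIso ?_
  rintro i _ _ _ rfl rfl rfl a b ha hb
  rw [splice_d] at hb ⊢
  exact coneExact_etaMinusF (coneExact_of_quasiIso f) i a b ha hb

theorem quasiIso_etaPlus (f : A ⟶ B) [QuasiIso f] : QuasiIso (etaPlus f) := by
  have := quasiIso_etaMinus f
  have : QuasiIso (etaMinus f ≫ etaPlus f) := by rwa [etaMinus_comp_etaPlus]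
  exact quasiIso_of_comp_left (etaMinus f) (etaPlus f)

/-- Only degree zero is new. Its term is a module of cone cycles, hence a direct summand of `B⁰ ⊕
A¹`. -/
theorem IsVectorBundleComplex.splice {f : A ⟶ B} [QuasiIso f] (hA : IsVectorBundleComplex A)
    (hB : IsVectorBundleComplex B) : IsVectorBundleComplex (QuadCplx.splice f) := by
  obtain ⟨r, hr⟩ := exists_retraction_ker_coneD (coneExact_of_quasiIso f) hA hB 0 1 2 rfl rfl
  have hAf := hA.finite
  have hBf := hB.finite
  have hAp := hA.projective
  have hBp := hB.projective
  refine ⟨?_, fun i => ?_, fun i => ?_⟩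
  · obtain ⟨a, _, ha⟩ := hB.bounded
    obtain ⟨_, b, hb⟩ := hA.bounded
    refine ⟨min a (-1), max b 1, fun i hi => ?_⟩
    match i, hi with
    | Int.ofNat 0, hi => exact absurd hi (by simp)
    | Int.ofNat (n + 1), hi =>
      exact hb (Int.ofNat (n + 1)) (Or.inr (by simp only [Int.ofNat_eq_natCast] at *; omega))
    | Int.negSucc n, hi => exact ha (Int.negSucc n) (Or.inl (by omega))
  · match i with
    | Int.ofNat 0 =>
      exact Module.Finite.of_surjective r fun x => ⟨x.1, hr x⟩
    | Int.ofNat (n + 1) => exact hAf _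
    | Int.negSucc n => exact hBf _
  · match i with
    | Int.ofNat 0 =>
      exact Module.Projective.of_split (Submodule.subtype _) r (LinearMap.ext hr)
    | Int.ofNat (n + 1) => exact hAp _
    | Int.negSucc n => exact hBp _

end Splicing

/-! ### Unique lifting between the two classes of maps -/

section Lifting

variable {R : Type u} [CommRing R]

theorem inv_hom_apply {M N : ModuleCat.{u} R} (f : M ⟶ N) [IsIso f] (x : N) :
    f.hom ((inv f).hom x) = x :=
  congrArg (fun t => t.hom x) (IsIso.inv_hom_id f)

theorem hom_inv_apply {M N : ModuleCat.{u} R} (f : M ⟶ N) [IsIso f] (x : M) :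
    (inv f).hom (f.hom x) = x :=
  congrArg (fun t => t.hom x) (IsIso.hom_inv_id f)

theorem injective_of_isIso {M N : ModuleCat.{u} R} (f : M ⟶ N) [IsIso f] :
    Function.Injective f.hom :=
  Function.LeftInverse.injective (hom_inv_apply f)

variable {A B S S' : Cplx R} {m : A ⟶ S} {p : S' ⟶ B}

/-- The term in degree zero of a complex `S'` with a quasi-isomorphism `p : S' ⟶ B` which is an
isomorphism in negative degrees embeds in `B⁰ ⊕ S'¹`. -/
theorem eq_of_p_eq_of_d_eq [QuasiIso p] (hp : ∀ i ≤ -1, IsIso (p.f i)) {x y : S'.X 0}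
    (h1 : (p.f 0).hom x = (p.f 0).hom y) (h2 : (S'.d 0 1).hom x = (S'.d 0 1).hom y) : x = y := by
  rw [← sub_eq_zero] at h1 h2 ⊢
  rw [← map_sub] at h1 h2
  obtain ⟨x', b, h3, h4⟩ := coneExact_of_quasiIso p (-2) (-1) 0 1 rfl rfl rfl (x - y) 0 h2
    (by rw [h1, map_zero])
  have := hp (-1) le_rfl
  have := hp (-2) (by norm_num)
  have h5 : x' = -(S'.d (-2) (-1)).hom ((inv (p.f (-2))).hom b) := by
    apply injective_of_isIso (p.f (-1))
    rw [map_neg, ← comm_apply, inv_hom_apply, eq_neg_iff_add_eq_zero, h4]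
  rw [← h3, h5, map_neg, d_d_apply, neg_zero]

/-- Together with `eq_of_p_eq_of_d_eq` this identifies `S'⁰` with the module of compatible pairs
`(b, s)`, as in a splicing. -/
theorem exists_of_d_eq_p [QuasiIso p] (hp : ∀ i ≤ -1, IsIso (p.f i)) (b : B.X 0) (s : S'.X 1)
    (h1 : (B.d 0 1).hom b = (p.f 1).hom s) (h2 : (S'.d 1 2).hom s = 0) :
    ∃ x : S'.X 0, (p.f 0).hom x = b ∧ (S'.d 0 1).hom x = s := by
  obtain ⟨x, b', h3, h4⟩ := coneExact_of_quasiIso p (-1) 0 1 2 rfl rfl rfl s b h2 h1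
  have := hp (-1) le_rfl
  refine ⟨x + (S'.d (-1) 0).hom ((inv (p.f (-1))).hom b'), ?_, ?_⟩
  · rw [map_add, ← comm_apply, inv_hom_apply, h4]
  · rw [map_add, d_d_apply, add_zero, h3]

/-- The map `m` determines a lift in positive degrees and `p` determines it in negative ones. In
degree zero its values are fixed by their images under `p` and `d`. -/
theorem lift_unique [QuasiIso p] (hm : ∀ i : ℤ, 1 ≤ i → IsIso (m.f i))
    (hp : ∀ i ≤ -1, IsIso (p.f i)) {w w' : S ⟶ S'} (h1 : m ≫ w = m ≫ w')
    (h2 : w ≫ p = w' ≫ p) : w = w' := by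
  have hpos : ∀ i : ℤ, 1 ≤ i → w.f i = w'.f i := fun i hi => by
    have := hm i hi
    rw [← cancel_epi (m.f i)]
    exact congrArg (fun t => t.f i) h1
  have hneg : ∀ i : ℤ, i ≤ -1 → w.f i = w'.f i := fun i hi => by
    have := hp i hi
    rw [← cancel_mono (p.f i)]
    exact congrArg (fun t => t.f i) h2
  refine HomologicalComplex.hom_ext _ _ fun i => ?_
  rcases lt_trichotomy i 0 with h | rfl | h
  · exact hneg i (by omega)
  · refine ModuleCat.hom_ext (LinearMap.ext fun x => ?_)
    refine eq_of_p_eq_of_d_eq hp (congrArg (fun t => (t.f 0).hom x) h2) ?_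
    rw [comm_apply, comm_apply, hpos 1 le_rfl]
  · exact hpos i (by omega)

theorem exists_lift_zero [QuasiIso p] (hp : ∀ i ≤ -1, IsIso (p.f i)) {M : ModuleCat.{u} R}
    (b : M ⟶ B.X 0) (s : M ⟶ S'.X 1) (h1 : b ≫ B.d 0 1 = s ≫ p.f 1)
    (h2 : s ≫ S'.d 1 2 = 0) : ∃ x : M ⟶ S'.X 0, x ≫ p.f 0 = b ∧ x ≫ S'.d 0 1 = s := by
  have key : ∀ y : M, ∃ x : S'.X 0, (p.f 0).hom x = b.hom y ∧ (S'.d 0 1).hom x = s.hom y :=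
    fun y => exists_of_d_eq_p hp _ _ (congrArg (fun t => t.hom y) h1)
      (congrArg (fun t => t.hom y) h2)
  choose x hx1 hx2 using key
  -- The pointwise choice is automatically linear, since the pair of images determines the element.
  refine ⟨ModuleCat.ofHom { toFun := x, map_add' := fun y z => ?_, map_smul' := fun c y => ?_ },
    ModuleCat.hom_ext (LinearMap.ext hx1), ModuleCat.hom_ext (LinearMap.ext hx2)⟩
  · refine eq_of_p_eq_of_d_eq hp ?_ ?_
    · simp only [map_add, hx1]
    · simp only [map_add, hx2]
  · refine eq_of_p_eq_of_d_eq hp ?_ ?_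
    · simp only [map_smul, hx1, RingHom.id_apply]
    · simp only [map_smul, hx2, RingHom.id_apply]

/-- Morphisms which are isomorphisms in positive degrees lift against quasi-isomorphisms which are
isomorphisms in negative degrees. -/
theorem exists_square_lift [QuasiIso p] (hm : ∀ i : ℤ, 1 ≤ i → IsIso (m.f i))
    (hp : ∀ i ≤ -1, IsIso (p.f i)) (a : A ⟶ S') (b : S ⟶ B) (hab : m ≫ b = a ≫ p) :
    ∃ c : S ⟶ S', m ≫ c = a ∧ c ≫ p = b := by
  have hab' : ∀ i, m.f i ≫ b.f i = a.f i ≫ p.f i := fun i => congrArg (fun t => t.f i) hab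
  have hm1 := hm 1 le_rfl
  have hm2 := hm 2 (by norm_num)
  -- The second component is forced: a lift `c` has `c₁ = m₁⁻¹ a₁` in degree one and commutes with
  -- `d`.
  obtain ⟨x, hx1, hx2⟩ := exists_lift_zero hp (b.f 0) (S.d 0 1 ≫ inv (m.f 1) ≫ a.f 1)
    (by
      rw [Category.assoc, Category.assoc, ← hab' 1, IsIso.inv_hom_id_assoc, b.comm])
    (by
      have h : inv (m.f 1) ≫ A.d 1 2 = S.d 1 2 ≫ inv (m.f 2) := by
        rw [IsIso.inv_comp_eq, m.comm_assoc, IsIso.hom_inv_id, Category.comp_id]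
      rw [Category.assoc, Category.assoc, a.comm, reassoc_of% h, S.d_comp_d_assoc,
        Limits.zero_comp])
  have key : ∀ i : ℤ, ∃ y : S.X i ⟶ S'.X i, m.f i ≫ y = a.f i ∧ y ≫ p.f i = b.f i ∧
      (∀ h : i = 0, y ≫ S'.d i 1 = S.d i 1 ≫ inv (m.f 1) ≫ a.f 1) := by
    intro i
    rcases lt_trichotomy i 0 with h | rfl | h
    · have := hp i (by omega)
      exact ⟨b.f i ≫ inv (p.f i), by rw [← Category.assoc, hab', Category.assoc,
        IsIso.hom_inv_id, Category.comp_id], by simp, fun h' => by omega⟩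
    · refine ⟨x, ?_, hx1, fun _ => hx2⟩
      refine ModuleCat.hom_ext (LinearMap.ext fun z => ?_)
      refine eq_of_p_eq_of_d_eq hp ?_ ?_
      · exact congrArg (fun t => t.hom z) ((congrArg _ hx1).trans (hab' 0))
      · have : m.f 0 ≫ x ≫ S'.d 0 1 = a.f 0 ≫ S'.d 0 1 := by
          rw [hx2, m.comm_assoc, IsIso.hom_inv_id_assoc, a.comm]
        exact congrArg (fun t => t.hom z) this
    · have := hm i (by omega)
      refine ⟨inv (m.f i) ≫ a.f i, by simp, ?_, fun h' => by omega⟩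
      rw [Category.assoc, ← hab', IsIso.inv_hom_id_assoc]
  choose y hy1 hy2 hy3 using key
  refine ⟨{ f := y, comm' := ?_ }, HomologicalComplex.hom_ext _ _ hy1,
    HomologicalComplex.hom_ext _ _ hy2⟩
  rintro i _ rfl
  rcases lt_trichotomy (i + 1) 0 with h | h | h
  · have := hp (i + 1) (by omega)
    rw [← cancel_mono (p.f (i + 1)), Category.assoc, Category.assoc, hy2, ← p.comm,
      reassoc_of% (hy2 i), b.comm]
  · obtain rfl : i = -1 := by omega
    refine ModuleCat.hom_ext (LinearMap.ext fun z => ?_)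
    refine eq_of_p_eq_of_d_eq hp ?_ ?_
    · have : (y (-1) ≫ S'.d (-1) 0) ≫ p.f 0 = (S.d (-1) 0 ≫ y 0) ≫ p.f 0 := by
        rw [Category.assoc, Category.assoc, hy2, ← p.comm, reassoc_of% (hy2 (-1)), b.comm]
      exact congrArg (fun t => t.hom z) this
    · have : (y (-1) ≫ S'.d (-1) 0) ≫ S'.d 0 1 = (S.d (-1) 0 ≫ y 0) ≫ S'.d 0 1 := by
        rw [Category.assoc, Category.assoc, hy3 0 rfl, S'.d_comp_d, S.d_comp_d_assoc,
          Limits.zero_comp, Limits.comp_zero]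
      exact congrArg (fun t => t.hom z) this
  · rcases eq_or_lt_of_le (show 0 ≤ i by omega) with rfl | h'
    · have h1 : y 1 = inv (m.f 1) ≫ a.f 1 := by rw [IsIso.eq_inv_comp, hy1]
      exact (hy3 0 rfl).trans (congrArg _ h1.symm)
    · have := hm i (by omega)
      have := hm (i + 1) (by omega)
      rw [← cancel_epi (m.f i), reassoc_of% (hy1 i), m.comm_assoc, hy1, a.comm]

end Lifting

/-! ### Pairings, transposes and self-dual isomorphisms -/

section Duality

variable {R : Type u} [CommRing R] {A A' B B' : Cplx R}

/-- The pairing between `Aⁱ` and `Bʲ`, for `i + j = 0`, given by a morphism `A ⟶ Bᵛ`. -/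
def pr (t : A ⟶ dual B) (i j : ℤ) (h : i + j = 0) (x : A.X i) (y : B.X j) : R :=
  (show Module.Dual R (B.X (-i)) from (t.f i).hom x)
    ((B.XIsoOfEq (show j = -i by omega)).hom.hom y)

theorem pr_neg (t : A ⟶ dual B) (i : ℤ) (x : A.X i) (y : B.X (-i)) :
    pr t i (-i) (by omega) x y = (show Module.Dual R (B.X (-i)) from (t.f i).hom x) y := by
  rw [pr, HomologicalComplex.XIsoOfEq_rfl]
  rfl

theorem pr_ext {t t' : A ⟶ dual B} (h : ∀ i j hij x y, pr t i j hij x y = pr t' i j hij x y) :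
    t = t' := by
  refine HomologicalComplex.hom_ext _ _ fun i => ModuleCat.hom_ext (LinearMap.ext fun x => ?_)
  refine LinearMap.ext (f := show Module.Dual R (B.X (-i)) from (t.f i).hom x)
    (g := show Module.Dual R (B.X (-i)) from (t'.f i).hom x) fun y => ?_
  have := h i (-i) (by omega) x y
  rwa [pr_neg, pr_neg] at this

theorem pr_add_left (t : A ⟶ dual B) (i j : ℤ) (h : i + j = 0) (x x' : A.X i) (y : B.X j) :
    pr t i j h (x + x') y = pr t i j h x y + pr t i j h x' y := by
  obtain rfl : j = -i := by omega
  simp only [pr_neg]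
  rw [map_add]
  rfl

theorem pr_add_right (t : A ⟶ dual B) (i j : ℤ) (h : i + j = 0) (x : A.X i) (y y' : B.X j) :
    pr t i j h x (y + y') = pr t i j h x y + pr t i j h x y' := by
  obtain rfl : j = -i := by omega
  simp only [pr_neg]
  exact map_add _ y y'

theorem pr_smul_left (t : A ⟶ dual B) (i j : ℤ) (h : i + j = 0) (c : R) (x : A.X i) (y : B.X j) :
    pr t i j h (c • x) y = c * pr t i j h x y := by
  obtain rfl : j = -i := by omega
  simp only [pr_neg]
  rw [map_smul]
  rfl

theorem pr_smul_right (t : A ⟶ dual B) (i j : ℤ) (h : i + j = 0) (c : R) (x : A.X i)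
    (y : B.X j) : pr t i j h x (c • y) = c * pr t i j h x y := by
  obtain rfl : j = -i := by omega
  simp only [pr_neg]
  exact LinearMap.map_smul _ c y

theorem pr_zero_right (t : A ⟶ dual B) (i j : ℤ) (h : i + j = 0) (x : A.X i) :
    pr t i j h x 0 = 0 := by
  rw [← zero_smul R (0 : B.X j), pr_smul_right, zero_mul]

/-- This is compatibility of `t` with differentials; no sign appears because the dual differentials
carry none. -/
theorem pr_d (t : A ⟶ dual B) (i j k l : ℤ) (hij : i + 1 = j) (hkl : k + 1 = l) (h : j + k = 0)
    (x : A.X i) (y : B.X k) :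
    pr t j k h ((A.d i j).hom x) y = pr t i l (by omega) x ((B.d k l).hom y) := by
  obtain rfl : k = -j := by omega
  obtain rfl : l = -i := by omega
  rw [pr_neg, pr_neg, ← comm_apply]
  rfl

theorem pr_comp (t : A ⟶ dual B) (f : A' ⟶ A) (g : B' ⟶ B) (i j : ℤ) (h : i + j = 0)
    (x : A'.X i) (y : B'.X j) :
    pr (f ≫ t ≫ dualMap g) i j h x y = pr t i j h ((f.f i).hom x) ((g.f j).hom y) := by
  obtain rfl : j = -i := by omega
  rw [pr_neg, pr_neg]
  rfl

/-- The transpose `B ⟶ Aᵛ` of a morphism `A ⟶ Bᵛ`. -/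
def tr (t : A ⟶ dual B) : B ⟶ dual A := ev B ≫ dualMap t

theorem pr_tr (t : A ⟶ dual B) (i j : ℤ) (h : i + j = 0) (h' : j + i = 0) (x : B.X i)
    (y : A.X j) : pr (tr t) i j h x y = pr t j i h' y x := by
  obtain rfl : j = -i := by omega
  rw [pr_neg]
  rfl

theorem isSelfDual_iff_tr {t : A ⟶ dual A} : IsSelfDual t ↔ tr t = t := Iff.rfl

theorem isSelfDual_iff {t : A ⟶ dual A} :
    IsSelfDual t ↔ ∀ i j (h : i + j = 0) (h' : j + i = 0) x y, pr t i j h x y = pr t j i h' y x := by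
  rw [isSelfDual_iff_tr]
  refine ⟨fun ht i j h h' x y => ?_, fun ht => pr_ext fun i j h x y => ?_⟩
  · conv_lhs => rw [← ht]
    exact pr_tr t i j h h' x y
  · rw [pr_tr t i j h (by omega), ht]

theorem tr_comp (f : A' ⟶ A) (t : A ⟶ dual B) (g : B' ⟶ B) :
    tr (f ≫ t ≫ dualMap g) = g ≫ tr t ≫ dualMap f := by
  refine pr_ext fun i j h x y => ?_
  rw [pr_tr _ i j h (by omega), pr_comp, pr_comp, pr_tr _ i j h]

theorem tr_comp_left (f : A' ⟶ A) (t : A ⟶ dual B) : tr (f ≫ t) = tr t ≫ dualMap f := by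
  have := tr_comp f t (𝟙 B)
  rwa [dualMap_id, Category.comp_id, Category.id_comp] at this

theorem tr_comp_right (t : A ⟶ dual B) (g : B' ⟶ B) : tr (t ≫ dualMap g) = g ≫ tr t := by
  have := tr_comp (𝟙 A) t g
  rwa [dualMap_id, Category.comp_id, Category.id_comp] at this

theorem tr_tr (t : A ⟶ dual B) : tr (tr t) = t := by
  refine pr_ext fun i j h x y => ?_
  rw [pr_tr _ i j h (by omega), pr_tr]

theorem IsSelfDual.pullback {t : B ⟶ dual B} (ht : IsSelfDual t) (f : A ⟶ B) :
    IsSelfDual (f ≫ t ≫ dualMap f) := by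
  rw [isSelfDual_iff_tr] at ht ⊢
  rw [tr_comp, ht]

theorem isIso_dualHom {M N : ModuleCat.{u} R} (f : M ⟶ N) [IsIso f] : IsIso (dualHom f) :=
  ⟨dualHom (inv f), by rw [← dualHom_comp, IsIso.inv_hom_id]; rfl,
    by rw [← dualHom_comp, IsIso.hom_inv_id]; rfl⟩

theorem isIso_dualMap_f (f : A ⟶ B) (i : ℤ) (h : IsIso (f.f (-i))) : IsIso ((dualMap f).f i) :=
  isIso_dualHom (f.f (-i))

theorem isIso_ev (hA : IsVectorBundleComplex A) : IsIso (ev A) := by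
  have (i : ℤ) : IsIso ((ev A).f i) := by
    have := hA.finite (- -i)
    have := hA.projective (- -i)
    have : IsIso (evHom (A.X (- -i))) := by
      rw [ConcreteCategory.isIso_iff_bijective]
      exact Module.bijective_dual_eval R (A.X (- -i))
    exact inferInstanceAs (IsIso ((A.XIsoOfEq (neg_neg i).symm).hom ≫ evHom (A.X (- -i))))
  exact HomologicalComplex.Hom.isIso_of_components (ev A)

theorem isIso_tr_f (hB : IsVectorBundleComplex B) (t : A ⟶ dual B) (i : ℤ) (h : IsIso (t.f (-i))) :
    IsIso ((tr t).f i) := by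
  have := isIso_ev hB
  have := isIso_dualMap_f t i h
  exact inferInstanceAs (IsIso ((ev B).f i ≫ (dualMap t).f i))

/-- Between finite length complexes of vector bundles, an isomorphism in the derived category is a
homotopy equivalence, and homotopies can be dualized. -/
theorem isIso_Q_map_dualMap [HasDerivedCategory.{w} (ModuleCat.{u} R)]
    (hA : IsVectorBundleComplex A) (hB : IsVectorBundleComplex B) (f : A ⟶ B)
    [IsIso (DerivedCategory.Q.map f)] : IsIso (DerivedCategory.Q.map (dualMap f)) := by
  obtain ⟨g, hg⟩ := exists_lift hB (inv (DerivedCategory.Q.map f))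
  obtain ⟨h1⟩ := homotopy_of_map_eq hA (φ := f ≫ g) (ψ := 𝟙 A) (by simp [hg])
  obtain ⟨h2⟩ := homotopy_of_map_eq hB (φ := g ≫ f) (ψ := 𝟙 B) (by simp [hg])
  refine ⟨DerivedCategory.Q.map (dualMap g), ?_, ?_⟩
  · have := map_eq_of_homotopy (dualHomotopy h2)
    rwa [dualMap_comp, dualMap_id, Functor.map_comp, CategoryTheory.Functor.map_id] at this
  · have := map_eq_of_homotopy (dualHomotopy h1)
    rwa [dualMap_comp, dualMap_id, Functor.map_comp, CategoryTheory.Functor.map_id] at this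

theorem quasiIso_dualMap (hA : IsVectorBundleComplex A) (hB : IsVectorBundleComplex B)
    (f : A ⟶ B) [QuasiIso f] : QuasiIso (dualMap f) := by
  let := HasDerivedCategory.standard (ModuleCat.{u} R)
  have := (DerivedCategory.isIso_Q_map_iff_quasiIso (C := ModuleCat.{u} R) f).2 inferInstance
  exact (DerivedCategory.isIso_Q_map_iff_quasiIso (C := ModuleCat.{u} R) _).1 (isIso_Q_map_dualMap hA hB f)

/-- If a self-dual morphism `t : A ⟶ Aᵛ` factors as a quasi-isomorphism `m : A ⟶ S` which is an
isomorphism in positive degrees and a quasi-isomorphism `p : S ⟶ Aᵛ` which is an isomorphism in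
negative degrees, then `S` carries a self-dual isomorphism which induces `t`. -/
theorem exists_selfDual_iso {A S : Cplx R} (hA : IsVectorBundleComplex A)
    (hS : IsVectorBundleComplex S) (m : A ⟶ S) (p : S ⟶ dual A) [QuasiIso m] [QuasiIso p]
    (hm : ∀ i : ℤ, 1 ≤ i → IsIso (m.f i)) (hp : ∀ i ≤ -1, IsIso (p.f i))
    (h : IsSelfDual (m ≫ p)) :
    ∃ θ : S ≅ dual S, IsSelfDual θ.hom ∧ θ.hom ≫ dualMap m = p := by
  have hm' : ∀ i ≤ -1, IsIso ((dualMap m).f i) := fun i hi =>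
    isIso_dualMap_f m i (hm _ (by omega))
  have hp' : ∀ i : ℤ, 1 ≤ i → IsIso ((tr p).f i) := fun i hi =>
    isIso_tr_f hA p i (hp _ (by omega))
  have := quasiIso_dualMap hA hS m
  -- Self-duality of the composite says that the transposed factorization has the same composite.
  -- Lifting in both directions then gives mutually inverse maps.
  have h' : m ≫ p = tr p ≫ dualMap m := by
    rw [← tr_comp_left]
    exact (isSelfDual_iff_tr.1 h).symm
  obtain ⟨θ, h1, h2⟩ := exists_square_lift hm hm' (tr p) p h'
  obtain ⟨θ', h3, h4⟩ := exists_square_lift hp' hp m (dualMap m) h'.symm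
  refine ⟨⟨θ, θ', ?_, ?_⟩, ?_, h2⟩
  · exact lift_unique hm hp (by rw [reassoc_of% h1, h3, Category.comp_id])
      (by rw [Category.assoc, h4, h2, Category.id_comp])
  · exact lift_unique hp' hm' (by rw [reassoc_of% h3, h1, Category.comp_id])
      (by rw [Category.assoc, h2, h4, Category.id_comp])
  -- The transpose of `θ` solves the same lifting problem as `θ`.
  · rw [isSelfDual_iff_tr]
    refine lift_unique hm hm' ?_ ?_
    · change m ≫ tr θ = m ≫ θ
      rw [h1, ← tr_comp_right, h2]
    · change tr θ ≫ dualMap m = θ ≫ dualMap m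
      rw [h2, ← tr_comp_left, h1, tr_tr]

end Duality

/-! ### Self-dual representatives of the form -/

section Representation

variable {R : Type u} [CommRing R] [HasDerivedCategory.{w} (ModuleCat.{u} R)]

open DerivedCategory

theorem quasiIso_iff_isIso_Q_map {A B : Cplx R} (f : A ⟶ B) :
    QuasiIso f ↔ IsIso (Q.map f) :=
  (isIso_Q_map_iff_quasiIso (C := ModuleCat.{u} R) f).symm

theorem isIso_derivedTranspose {E F : DerivedCategory (ModuleCat.{u} R)} (p : Model E)
    (q : Model F) (f : E ⟶ F) [IsIso f] : IsIso (derivedTranspose p q f) :=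
  ⟨derivedTranspose q p (inv f),
    by rw [← derivedTranspose_comp, IsIso.inv_hom_id, derivedTranspose_id],
    by rw [← derivedTranspose_comp, IsIso.hom_inv_id, derivedTranspose_id]⟩

theorem dualOfRepresentation_comp {E : DerivedCategory (ModuleCat.{u} R)} (hE : IsPerfect E)
    {C C' : Cplx R} (hC : IsVectorBundleComplex C) (hC' : IsVectorBundleComplex C')
    (a : C' ⟶ C) (α : Q.obj C ⟶ E) :
    dualOfRepresentation hE hC' (Q.map a ≫ α) =
      dualOfRepresentation hE hC α ≫ Q.map (dualMap a) := by
  rw [dualOfRepresentation, derivedTranspose_comp _ (Model.self C hC),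
    derivedTranspose_eq (Model.self C' hC') (Model.self C hC) (Q.map a) a (by simp)]
  rfl

/-- A morphism of complexes representing the form can be pulled back along quasi-isomorphisms. -/
theorem represents_pullback_iff (E : QuadraticComplex.{w} R) {C C' : Cplx R}
    (hC : IsVectorBundleComplex C) (hC' : IsVectorBundleComplex C') (a : C' ⟶ C)
    (α : Q.obj C ≅ E.obj) (α' : Q.obj C' ≅ E.obj) (h : Q.map a ≫ α.hom = α'.hom)
    (t : C ⟶ dual C) :
    Represents E hC' (a ≫ t ≫ dualMap a) α' ↔ Represents E hC t α := by
  have : IsIso (Q.map a) := by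
    rw [← Iso.eq_comp_inv] at h
    rw [h]
    infer_instance
  have := isIso_Q_map_dualMap hC' hC a
  rw [Represents, Represents, ← h, dualOfRepresentation_comp E.isPerfect hC hC']
  simp only [Functor.map_comp, Category.assoc]
  rw [cancel_epi]
  rw [← Category.assoc, ← Category.assoc, cancel_mono, Category.assoc]

theorem Represents.isIso {E : QuadraticComplex.{w} R} {C : Cplx R}
    {hC : IsVectorBundleComplex C} {t : C ⟶ dual C} {α : Q.obj C ≅ E.obj}
    (h : Represents E hC t α) : IsIso (Q.map t) := by
  have : IsIso (dualOfRepresentation E.isPerfect hC α.hom) :=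
    isIso_derivedTranspose _ _ _
  rw [← (show _ = _ from h)]
  infer_instance

/-- The form of a quadratic complex on its model is homotopic to its transpose. -/
theorem exists_represents_model (E : QuadraticComplex.{w} R) :
    ∃ φ : E.isPerfect.model.cplx ⟶ dual E.isPerfect.model.cplx,
      Represents E E.isPerfect.model.isVB φ E.isPerfect.model.iso ∧
      Q.map (tr φ) = Q.map φ := by
  obtain ⟨φ, hφ⟩ := exists_lift E.isPerfect.model.isVB (E.isPerfect.model.iso.hom ≫ E.θ.hom)
  refine ⟨φ, ?_, ?_⟩
  · have h : dualOfRepresentation E.isPerfect E.isPerfect.model.isVB E.isPerfect.model.iso.hom =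
        𝟙 _ := by
      rw [dualOfRepresentation, derivedTranspose_eq (Model.self _ E.isPerfect.model.isVB)
        E.isPerfect.model _ (𝟙 E.isPerfect.model.cplx) (by simp),
        dualMap_id,
        CategoryTheory.Functor.map_id]
    rw [Represents, h, Category.comp_id, hφ]
  · have h := E.self_dual
    -- By functoriality of `derivedTranspose`, the auxiliary model of the derived dual cancels,
    -- leaving evaluation followed by the dual of `φ`.
    rw [biduality, derivedDualMap, Category.assoc, Category.assoc, ← derivedTranspose_comp,
      Category.comp_id, derivedTranspose_eq _ _ _ φ (by simpa using hφ)] at h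
    rw [tr, Functor.map_comp, hφ, ← h]
    simp

/-- A lift `φ` of the form is homotopic to its transpose. Half of `tr φ + φ` is therefore homotopic
to `φ`, and it is strictly self-dual. -/
theorem exists_selfDual_represents (h2 : IsUnit (2 : R)) (E : QuadraticComplex.{w} R) :
    ∃ (A : Cplx R) (hA : IsVectorBundleComplex A) (t : A ⟶ dual A) (β : Q.obj A ≅ E.obj),
      IsSelfDual t ∧ Represents E hA t β := by
  obtain ⟨φ, hφ, h⟩ := exists_represents_model E
  obtain ⟨c, hc⟩ := h2.exists_left_inv
  obtain ⟨H⟩ := homotopy_of_map_eq E.isPerfect.model.isVB h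
  refine ⟨_, E.isPerfect.model.isVB, c • (tr φ + φ), E.isPerfect.model.iso, ?_, ?_⟩
  · rw [isSelfDual_iff]
    have key : ∀ i j (h : i + j = 0) x y, pr (c • (tr φ + φ)) i j h x y =
        c * (pr φ j i (by omega) y x + pr φ i j h x y) := by
      intro i j h x y
      rw [← pr_tr φ i j h]
      obtain rfl : j = -i := by omega
      simp only [pr_neg]
      rfl
    intro i j h h' x y
    rw [key, key, add_comm]
  · have H' : Homotopy (c • (tr φ + φ)) φ := by
      refine ((H.add (Homotopy.refl φ)).smul c).trans (Homotopy.ofEq ?_)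
      rw [← two_smul R φ, smul_smul, hc, one_smul]
    rw [Represents] at hφ ⊢
    rw [hφ, map_eq_of_homotopy H']

/-- The isomorphism comes from the factorization `t = η⁺ η⁻`. That it represents the form can be
tested after pulling back along `η⁻`, where it becomes `t`. -/
theorem exists_selfDualRepStructure_splice (E : QuadraticComplex.{w} R) (A : Cplx R)
    (hA : IsVectorBundleComplex A) (t : A ⟶ dual A) (β : Q.obj A ≅ E.obj) (ht : IsSelfDual t)
    (h : Represents E hA t β) :
    ∃ S : SelfDualRepStructure E (splice t),
      Q.map (etaMinus t) ≫ S.α.hom = β.hom ∧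
      S.θ.hom ≫ dualMap (etaMinus t) = etaPlus t := by
  have : QuasiIso t := (quasiIso_iff_isIso_Q_map t).2 h.isIso
  have := quasiIso_etaMinus t
  have := quasiIso_etaPlus t
  have hS := hA.splice (f := t) hA.dual
  obtain ⟨θ, hθ, hθ'⟩ := exists_selfDual_iso hA hS (etaMinus t) (etaPlus t) (isIso_etaMinus_f t)
    (isIso_etaPlus_f t) (by rwa [etaMinus_comp_etaPlus])
  have := (quasiIso_iff_isIso_Q_map (etaMinus t)).1 inferInstance
  let α : Q.obj (splice t) ≅ E.obj := (asIso (Q.map (etaMinus t))).symm ≪≫ β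
  have hα : Q.map (etaMinus t) ≫ α.hom = β.hom := by simp [α]
  refine ⟨⟨hS, θ, hθ, α, ?_⟩, hα, hθ'⟩
  rw [← represents_pullback_iff E hS hA (etaMinus t) α β hα, hθ', etaMinus_comp_etaPlus]
  exact h

end Representation

/-! ### From generalized to genuine isotropic reductions -/

section Reductions

variable {R : Type u} [CommRing R]

theorem dualMap_surjective_of_leftInverse {M N : Type*} [AddCommGroup M] [AddCommGroup N]
    [Module R M] [Module R N] (f : M →ₗ[R] N) (r : N →ₗ[R] M) (h : ∀ x, r (f x) = x) :
    Function.Surjective f.dualMap := fun φ =>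
  ⟨φ ∘ₗ r, LinearMap.ext fun x => congrArg φ (h x)⟩

section

variable [HasDerivedCategory.{w} (ModuleCat.{u} R)]

open DerivedCategory

/-- Quasi-isomorphisms `S ⟵ A ⟶ G` inducing the same form, such that `A ⟶ G` is an isomorphism in
positive degrees and `A¹ ⟶ S¹` is a split monomorphism, yield an isotropic reduction. -/
theorem nonempty_isotropicReduction {E : QuadraticComplex.{w} R} (S G : SelfDualRep E)
    {A : Cplx R} (hA : IsVectorBundleComplex A) (j : A ⟶ S.cplx) (g : A ⟶ G.cplx) [QuasiIso j]
    [QuasiIso g] (hc : Q.map g ≫ G.str.α.hom = Q.map j ≫ S.str.α.hom)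
    (hg : ∀ i : ℤ, 1 ≤ i → IsIso (g.f i))
    (hfg : g ≫ G.str.θ.hom ≫ dualMap g = j ≫ S.str.θ.hom ≫ dualMap j)
    (s : S.cplx.X 1 ⟶ A.X 1) (hs : j.f 1 ≫ s = 𝟙 _) :
    Nonempty (IsotropicReduction S G) := by
  have := quasiIso_etaMinus j
  have := quasiIso_etaPlus j
  have := quasiIso_dualMap hA G.str.isVB g
  have hj := hA.splice (f := j) S.str.isVB
  have := quasiIso_dualMap hA hj (etaMinus j)
  have hm := isIso_etaMinus_f j
  have hmj := etaMinus_comp_etaPlus j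
  -- Splicing `j` makes the leg to `S` an isomorphism in negative degrees. The leg `v` to `G` is a
  -- lift against `θ_G` followed by `gᵛ`; equality of the forms on `A` makes the square commute.
  obtain ⟨v, hv1, hv2⟩ := exists_square_lift (p := G.str.θ.hom ≫ dualMap g) hm
    (fun i hi => by
      have := isIso_dualMap_f g i (hg _ (by omega))
      exact inferInstanceAs (IsIso (G.str.θ.hom.f i ≫ (dualMap g).f i)))
    g (etaPlus j ≫ S.str.θ.hom ≫ dualMap j) (by rw [hfg, reassoc_of% hmj])
  have hv3 : g ≫ G.str.θ.hom ≫ dualMap v = j ≫ S.str.θ.hom ≫ dualMap (etaPlus j) := by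
    have h := congrArg tr hv2
    rwa [tr_comp, tr_comp, isSelfDual_iff_tr.1 G.str.self_dual,
      isSelfDual_iff_tr.1 S.str.self_dual] at h
  refine ⟨{
    A := splice j
    isVB := hj
    g := v
    f := etaPlus j
    quasiIso_g := ?_
    quasiIso_f := inferInstance
    compatible := ?_
    isIso_g := fun i hi => ?_
    isIso_f := isIso_etaPlus_f j
    forms := ?_
    inclusion := ?_ }⟩
  · have : QuasiIso (etaMinus j ≫ v) := by rwa [hv1]
    exact quasiIso_of_comp_left (etaMinus j) v
  · have := (quasiIso_iff_isIso_Q_map (etaMinus j)).1 inferInstance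
    rw [← cancel_epi (Q.map (etaMinus j)), ← Category.assoc, ← Category.assoc,
      ← Functor.map_comp, ← Functor.map_comp, hv1, hmj, hc]
  · have := hm i hi
    have := hg i hi
    have h : (etaMinus j).f i ≫ v.f i = g.f i := congrArg (fun t => t.f i) hv1
    rw [← IsIso.eq_inv_comp] at h
    rw [h]
    infer_instance
  -- Both forms are maps from the spliced complex to its dual, so it suffices to compare them after
  -- `η⁻` on one side and its dual on the other.
  · refine lift_unique (p := dualMap (etaMinus j)) hm
      (fun i hi => isIso_dualMap_f _ i (hm _ (by omega))) ?_ ?_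
    · rw [reassoc_of% hv1, hv3, reassoc_of% hmj]
    · rw [Category.assoc, Category.assoc, Category.assoc, Category.assoc, ← dualMap_comp,
        ← dualMap_comp, hv1, hmj, hv2]
  -- In degree one `η⁻` is invertible and turns `η⁺` into `j`, so `s` yields a retraction using only
  -- the first factor.
  · refine dualMap_surjective_of_leftInverse _
      ((s ≫ (etaMinus j).f 1).hom ∘ₗ LinearMap.fst R _ _) fun x => ?_
    have := hm 1 le_rfl
    have h : (etaPlus j).f 1 ≫ s ≫ (etaMinus j).f 1 = 𝟙 _ := by
      rw [← cancel_epi ((etaMinus j).f 1)]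
      have h1 : (etaMinus j).f 1 ≫ (etaPlus j).f 1 = j.f 1 := congrArg (fun t => t.f 1) hmj
      rw [reassoc_of% h1, reassoc_of% hs, Category.comp_id]
    exact congrArg (fun t => t.hom x) h

end

/-! ### Adding the contractible complex Cone(id) -/

section Stabilization

/-- The differential `(y, x, x') ↦ (d y, d x + x', -d x')`. -/
def stabD (F A : Cplx R) (i : ℤ) :
    ModuleCat.of R (F.X i × A.X i × A.X (i + 1)) ⟶
      ModuleCat.of R (F.X (i + 1) × A.X (i + 1) × A.X (i + 1 + 1)) :=
  ModuleCat.ofHom (LinearMap.prodMap (F.d i (i + 1)).hom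
    (((A.d i (i + 1)).hom.coprod LinearMap.id).prod
      (-(A.d (i + 1) (i + 1 + 1)).hom ∘ₗ LinearMap.snd R _ _)))

theorem stabD_comp (F A : Cplx R) (i : ℤ) : stabD F A i ≫ stabD F A (i + 1) = 0 := by
  refine ModuleCat.hom_ext (LinearMap.ext fun x => Prod.ext ?_ (Prod.ext ?_ ?_))
  · exact d_d_apply F _ _ _ x.1
  · change (A.d _ _).hom ((A.d _ _).hom x.2.1 + x.2.2) + -(A.d _ _).hom x.2.2 = 0
    rw [map_add, d_d_apply, zero_add, add_neg_cancel]
  · change -(A.d _ _).hom (-(A.d _ _).hom x.2.2) = 0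
    rw [map_neg, d_d_apply, neg_zero, neg_zero]

/-- The direct sum of `F` and the mapping cone of the identity of `A`. -/
def stab (F A : Cplx R) : Cplx R :=
  CochainComplex.of (fun i => ModuleCat.of R (F.X i × A.X i × A.X (i + 1))) (stabD F A)
    (stabD_comp F A)

theorem stab_d (F A : Cplx R) (i : ℤ) : (stab F A).d i (i + 1) = stabD F A i :=
  CochainComplex.of_d (fun i => ModuleCat.of R (F.X i × A.X i × A.X (i + 1))) (stabD F A) i

theorem IsVectorBundleComplex.stab {F A : Cplx R} (hF : IsVectorBundleComplex F)
    (hA : IsVectorBundleComplex A) : IsVectorBundleComplex (QuadCplx.stab F A) where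
  bounded := by
    obtain ⟨a, b, h⟩ := hF.bounded
    obtain ⟨a', b', h'⟩ := hA.bounded
    refine ⟨min a (a' - 1), max b b', fun i hi => ?_⟩
    have := h i (by omega)
    have := h' i (by omega)
    have := h' (i + 1) (by omega)
    exact inferInstanceAs (Subsingleton (F.X i × A.X i × A.X (i + 1)))
  finite i := by
    have := hF.finite i
    have := hA.finite i
    have := hA.finite (i + 1)
    exact inferInstanceAs (Module.Finite R (F.X i × A.X i × A.X (i + 1)))
  projective i := by
    have := hF.projective i
    have := hA.projective i
    have := hA.projective (i + 1)
    exact inferInstanceAs (Module.Projective R (F.X i × A.X i × A.X (i + 1)))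

/-- The projection `F ⊕ Cone(id_A) ⟶ F`. -/
def stabFst (F A : Cplx R) : stab F A ⟶ F where
  f i := ModuleCat.ofHom (LinearMap.fst R (F.X i) (A.X i × A.X (i + 1)))
  comm' i j hij := by
    obtain rfl : i + 1 = j := hij
    rw [stab_d]
    rfl

/-- The morphism `A ⟶ F ⊕ Cone(id_A)` given by a morphism `A ⟶ F` and the inclusion. -/
def stabLift {F A : Cplx R} (f : A ⟶ F) : A ⟶ stab F A where
  f i := ModuleCat.ofHom ((f.f i).hom.prod (LinearMap.inl R (A.X i) (A.X (i + 1))))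
  comm' i j hij := by
    obtain rfl : i + 1 = j := hij
    rw [stab_d]
    refine ModuleCat.hom_ext (LinearMap.ext fun x => Prod.ext ?_ (Prod.ext ?_ ?_))
    · exact comm_apply f _ _ x
    · exact add_zero _
    · exact (congrArg Neg.neg (map_zero (A.d (i + 1) (i + 1 + 1)).hom)).trans neg_zero

/-- The inclusion `F ⟶ F ⊕ Cone(id_A)`. -/
def stabInl (F A : Cplx R) : F ⟶ stab F A where
  f i := ModuleCat.ofHom (LinearMap.inl R (F.X i) (A.X i × A.X (i + 1)))
  comm' i j hij := by
    obtain rfl : i + 1 = j := hij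
    rw [stab_d]
    refine ModuleCat.hom_ext (LinearMap.ext fun x => Prod.ext rfl (Prod.ext ?_ ?_))
    · exact (add_zero _).trans (map_zero (A.d i (i + 1)).hom)
    · exact (congrArg Neg.neg (map_zero (A.d (i + 1) (i + 1 + 1)).hom)).trans neg_zero

/-- The cone of the identity is contractible: a cocycle `(x, x')` has `x' = -d x`, so it is the
differential of `(0, x)`. -/
theorem quasiIso_stabFst (F A : Cplx R) : QuasiIso (stabFst F A) := by
  refine ConeExact.quasiIso ?_
  rintro i _ _ _ rfl rfl rfl a b ha hb
  rw [stab_d] at ha ⊢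
  have h2 : (A.d _ _).hom a.2.1 + a.2.2 = 0 := congrArg (fun t => t.2.1) ha
  refine ⟨(b, 0, a.2.1), 0, Prod.ext hb (Prod.ext ?_ ?_), ?_⟩
  · exact (congrArg (· + a.2.1) (map_zero (A.d (i + 1) (i + 1 + 1)).hom)).trans (zero_add _)
  · exact neg_eq_of_add_eq_zero_right h2
  · exact (congrArg (b + ·) (map_zero _)).trans (add_zero _)

end Stabilization

variable [HasDerivedCategory.{w} (ModuleCat.{u} R)]

open DerivedCategory

/-- The cone summand makes `A ⟶ F ⊕ Cone(id_A)` split injective while `F` stays a direct summand.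
Splicing the pulled-back form preserves this in degree one, where `η⁻` is an isomorphism, and both
maps induce the prescribed forms because they do so after projection to `F`. -/
theorem exists_isotropicReductions {E : QuadraticComplex.{w} R} {F G : SelfDualRep E}
    (ρ : GenIsotropicReduction F G) :
    ∃ F' : SelfDualRep E, Nonempty (IsotropicReduction F' F) ∧
      Nonempty (IsotropicReduction F' G) := by
  have := ρ.quasiIso_f
  have := ρ.quasiIso_g
  have hF := F.str.isVB
  let p := stabFst F.cplx ρ.A
  have hB := hF.stab ρ.isVB
  have hp : QuasiIso p := quasiIso_stabFst F.cplx ρ.A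
  have hlp : stabLift ρ.f ≫ p = ρ.f := rfl
  have hip : stabInl F.cplx ρ.A ≫ p = 𝟙 _ := rfl
  have := (quasiIso_iff_isIso_Q_map p).1 hp
  let β : Q.obj (stab F.cplx ρ.A) ≅ E.obj := asIso (Q.map p) ≪≫ F.str.α
  have hβ : Q.map p ≫ F.str.α.hom = β.hom := rfl
  have hrep := (represents_pullback_iff E hF hB p F.str.α β hβ F.str.θ.hom).2 F.str.represents
  have hsd := F.str.self_dual.pullback p
  obtain ⟨t, ht⟩ : ∃ t, t = p ≫ F.str.θ.hom ≫ dualMap p := ⟨_, rfl⟩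
  rw [← ht] at hrep hsd
  obtain ⟨S, hS1, hS2⟩ := exists_selfDualRepStructure_splice E _ hB t β hsd hrep
  have hη : etaMinus t ≫ S.θ.hom ≫ dualMap (etaMinus t) = t := by
    rw [hS2, etaMinus_comp_etaPlus]
  have hforms : ∀ {C : Cplx R} (a : C ⟶ stab F.cplx ρ.A),
      (a ≫ etaMinus t) ≫ S.θ.hom ≫ dualMap (a ≫ etaMinus t) =
        (a ≫ p) ≫ F.str.θ.hom ≫ dualMap (a ≫ p) := fun a => by
    have h1 : (a ≫ etaMinus t) ≫ S.θ.hom ≫ dualMap (a ≫ etaMinus t) = a ≫ t ≫ dualMap a := by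
      conv_rhs => rw [← hη]
      simp only [dualMap_comp, Category.assoc]
    rw [h1, ht]
    simp only [dualMap_comp, Category.assoc]
  have hα : ∀ {C : Cplx R} (a : C ⟶ stab F.cplx ρ.A),
      Q.map (a ≫ p) ≫ F.str.α.hom = Q.map (a ≫ etaMinus t) ≫ S.α.hom := fun a => by
    rw [Functor.map_comp, Functor.map_comp, Category.assoc, Category.assoc, hS1, hβ]
  have : QuasiIso t := (quasiIso_iff_isIso_Q_map t).2 hrep.isIso
  have := quasiIso_etaMinus t
  have : QuasiIso (stabLift ρ.f ≫ p) := by rwa [hlp]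
  have : QuasiIso (stabLift ρ.f) := quasiIso_of_comp_right _ p
  have : QuasiIso (stabInl F.cplx ρ.A ≫ p) := by rw [hip]; infer_instance
  have : QuasiIso (stabInl F.cplx ρ.A) := quasiIso_of_comp_right _ p
  have := isIso_etaMinus_f t 1 le_rfl
  -- Projection to the middle summand of `F¹ ⊕ A¹ ⊕ A²`.
  let r : (stab F.cplx ρ.A).X 1 ⟶ ρ.A.X 1 :=
    ModuleCat.ofHom (LinearMap.fst R _ _ ∘ₗ LinearMap.snd R (F.cplx.X 1) _)
  have hr : (stabLift ρ.f).f 1 ≫ r = 𝟙 _ := rfl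
  refine ⟨⟨splice t, S⟩, ?_, ?_⟩
  · refine nonempty_isotropicReduction ⟨splice t, S⟩ F hF (stabInl F.cplx ρ.A ≫ etaMinus t) (𝟙 _)
      ?_ (fun i _ => inferInstance) ?_ (inv ((etaMinus t).f 1) ≫ p.f 1) ?_
    · rw [← hα, hip]
    · rw [hforms, hip]
    · rw [HomologicalComplex.comp_f, Category.assoc, IsIso.hom_inv_id_assoc]
      exact congrArg (fun t => t.f 1) hip
  · refine nonempty_isotropicReduction ⟨splice t, S⟩ G ρ.isVB (stabLift ρ.f ≫ etaMinus t) ρ.g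
      ?_ ρ.isIso_g ?_ (inv ((etaMinus t).f 1) ≫ r) ?_
    · rw [← hα, hlp, ρ.compatible]
    · rw [hforms, hlp, ρ.forms]
    · rw [HomologicalComplex.comp_f, Category.assoc, IsIso.hom_inv_id_assoc, hr]

end Reductions

/-! ### Modifying morphisms and forms by homotopies -/

section Homotopies

variable {R : Type u} [CommRing R] {A B : Cplx R}

/-- A morphism of complexes can be modified by a prescribed homotopy. -/
theorem exists_homotopic (φ : A ⟶ B) (k : ∀ i j : ℤ, A.X i ⟶ B.X j) :
    ∃ φ' : A ⟶ B, Nonempty (Homotopy φ' φ) ∧ ∀ i j l : ℤ, i + 1 = j → j + 1 = l → ∀ x : A.X j,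
      (φ'.f j).hom x = (φ.f j).hom x + (k l j).hom ((A.d j l).hom x) +
        (B.d i j).hom ((k j i).hom x) := by
  refine ⟨φ + Homotopy.nullHomotopicMap' (fun i j _ => k i j),
    ⟨((Homotopy.refl φ).add (Homotopy.nullHomotopy' _)).trans (Homotopy.ofEq (add_zero φ))⟩, ?_⟩
  intro i j l hij hjl x
  have h := Homotopy.nullHomotopicMap'_f (c := ComplexShape.up ℤ) hij hjl
    (fun i j _ => k i j : ∀ i j, (ComplexShape.up ℤ).Rel j i → (A.X i ⟶ B.X j))
  rw [HomologicalComplex.add_f_apply, h, add_assoc]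
  rfl

theorem Homotopy.comm_apply {φ ψ : A ⟶ B} (H : Homotopy φ ψ) (i j l : ℤ) (hij : i + 1 = j)
    (hjl : j + 1 = l) (x : A.X j) : (φ.f j).hom x =
      (H.hom l j).hom ((A.d j l).hom x) + (B.d i j).hom ((H.hom j i).hom x) + (ψ.f j).hom x := by
  have h := H.comm j
  rw [dNext_eq H.hom (show (ComplexShape.up ℤ).Rel j l from hjl),
    prevD_eq H.hom (show (ComplexShape.up ℤ).Rel i j from hij)] at h
  rw [h]
  rfl

/-- A quasi-isomorphism which is an isomorphism in positive degrees has a homotopy inverse with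
the same property. -/
theorem exists_homotopy_inverse [HasDerivedCategory.{w} (ModuleCat.{u} R)]
    (hA : IsVectorBundleComplex A) (m : B ⟶ A) [QuasiIso m]
    (hm : ∀ i : ℤ, 1 ≤ i → IsIso (m.f i)) :
    ∃ e : A ⟶ B, DerivedCategory.Q.map m ≫ DerivedCategory.Q.map e = 𝟙 _ ∧
      ∀ i : ℤ, 1 ≤ i → IsIso (e.f i) := by
  have := (quasiIso_iff_isIso_Q_map m).1 inferInstance
  obtain ⟨g, hg⟩ := exists_lift hA (inv (DerivedCategory.Q.map m))
  obtain ⟨H⟩ := homotopy_of_map_eq hA (φ := g ≫ m) (ψ := 𝟙 A) (by simp [hg])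
  -- Adding `k d + d k` to `g` should cancel the homotopy `H` from `m g` to the identity in degrees
  -- ≥ 1. There `m k = -H` is needed in the first term, but only `m d k = -d H` in the second; this
  -- matters for `k : A¹ ⟶ B⁰`, since `m₀` need not be invertible.
  have key : ∀ i j : ℤ, ∃ k : A.X i ⟶ B.X j, j + 1 = i →
      (2 ≤ i → ∀ x, (m.f j).hom (k.hom x) = -(H.hom i j).hom x) ∧
      (1 ≤ i → ∀ x, (m.f i).hom ((B.d j i).hom (k.hom x)) =
        -(A.d j i).hom ((H.hom i j).hom x)) := by
    intro i j
    by_cases hij : j + 1 = i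
    swap
    · exact ⟨0, fun h => absurd h hij⟩
    rcases lt_trichotomy i 1 with hi | rfl | hi
    · exact ⟨0, fun _ => ⟨fun h => by omega, fun h => by omega⟩⟩
    · obtain rfl : j = 0 := by omega
      have := hm 1 le_rfl
      have := hm 2 (by norm_num)
      have := hA.projective 1
      let ℓ : A.X 1 →ₗ[R] B.X 1 := -((inv (m.f 1)).hom ∘ₗ (A.d 0 1).hom ∘ₗ (H.hom 1 0).hom)
      have hℓ : ∀ x, (m.f 1).hom (ℓ x) = -(A.d 0 1).hom ((H.hom 1 0).hom x) := fun x => by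
        change (m.f 1).hom (-(inv (m.f 1)).hom _) = _
        rw [map_neg, inv_hom_apply]
        rfl
      -- The element `ℓ x` is a cocycle whose image under the quasi-isomorphism `m` is a boundary,
      -- hence a boundary itself. Projectivity of `A¹` then makes the choice of primitives linear.
      have hℓ' : ∀ x, ℓ x ∈ LinearMap.range (B.d 0 1).hom := fun x => by
        obtain ⟨y, hy⟩ := eq_d_of_quasiIso m (i := 0) (j := 1) (k := 2) rfl rfl (ℓ x)
          (-(H.hom 1 0).hom x) (by
            apply injective_of_isIso (m.f 2)
            rw [← comm_apply, hℓ, map_neg, d_d_apply, neg_zero, map_zero])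
          (by rw [hℓ, map_neg])
        exact ⟨y, hy⟩
      obtain ⟨k, hk⟩ := Module.projective_lifting_property (B.d 0 1).hom.rangeRestrict
        (ℓ.codRestrict _ hℓ') (LinearMap.surjective_rangeRestrict _)
      refine ⟨ModuleCat.ofHom k, fun _ => ⟨fun h => by omega, fun _ x => ?_⟩⟩
      rw [← hℓ]
      exact congrArg _ (congrArg Subtype.val (LinearMap.congr_fun hk x))
    · have := hm j (by omega)
      have hk : ∀ x, (m.f j).hom ((-(H.hom i j ≫ inv (m.f j))).hom x) = -(H.hom i j).hom x :=
        fun x => by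
          change (m.f j).hom (-(inv (m.f j)).hom _) = _
          rw [map_neg, inv_hom_apply]
          rfl
      refine ⟨-(H.hom i j ≫ inv (m.f j)), fun _ => ⟨fun _ => hk, fun _ x => ?_⟩⟩
      rw [← QuadCplx.comm_apply, hk, map_neg]
  choose k hk using key
  obtain ⟨e, ⟨He⟩, he⟩ := exists_homotopic g k
  refine ⟨e, by rw [map_eq_of_homotopy He, hg, IsIso.hom_inv_id], fun i hi => ?_⟩
  have := hm i hi
  have h : e.f i ≫ m.f i = 𝟙 _ := by
    refine ModuleCat.hom_ext (LinearMap.ext fun x => ?_)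
    have h1 := Homotopy.comm_apply H (i - 1) i (i + 1) (by omega) rfl x
    change (m.f i).hom ((e.f i).hom x) = x
    rw [he (i - 1) i (i + 1) (by omega) rfl, map_add, map_add,
      (hk (i + 1) i rfl).1 (by omega), (hk i (i - 1) (by omega)).2 hi]
    change (m.f i).hom ((g.f i).hom x) = _ + _ + x at h1
    rw [h1]
    abel
  rw [IsIso.eq_comp_inv _ |>.2 h, Category.id_comp]
  infer_instance

/-- A homotopy between self-dual morphisms is described by a symmetric pairing. -/
theorem exists_symmetric_homotopy {c : R} (hc : c * 2 = 1) {t t' : A ⟶ dual A} (ht : IsSelfDual t)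
    (ht' : IsSelfDual t') (H : Homotopy t t') :
    ∃ η : ∀ i j : ℤ, A.X i →ₗ[R] A.X j →ₗ[R] R, (∀ i j x y, η i j x y = η j i y x) ∧
      ∀ (i j k l : ℤ) (_ : i + 1 = k) (_ : j + 1 = l) (h : i + j = 0) (x : A.X i) (y : A.X j),
        pr t i j h x y =
          pr t' i j h x y + η k j ((A.d i k).hom x) y + η i l x ((A.d j l).hom y) := by
  -- The index `p` is kept apart from `-j` so that the identification of the two degrees can be
  -- removed by substitution.
  let η₁ : ∀ i p j : ℤ, j = -p → (A.X i →ₗ[R] A.X j →ₗ[R] R) := fun i p j h =>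
    (A.XIsoOfEq h).hom.hom.dualMap ∘ₗ
      (show A.X i →ₗ[R] Module.Dual R (A.X (-p)) from (H.hom i p).hom)
  let η₀ : ∀ i j : ℤ, A.X i →ₗ[R] A.X j →ₗ[R] R := fun i j => η₁ i (-j) j (neg_neg j).symm
  have h₁ : ∀ i p j (h : j = -p), η₁ i p j h = η₀ i j := by
    intro i p j h
    obtain rfl : p = -j := by omega
    rfl
  have h₀ : ∀ (i j k l : ℤ) (_ : i + 1 = k) (_ : j + 1 = l) (h : i + j = 0) (x : A.X i)
      (y : A.X j), pr t i j h x y =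
        pr t' i j h x y + η₀ k j ((A.d i k).hom x) y + η₀ i l x ((A.d j l).hom y) := by
    intro i j k l hk hl h x y
    obtain rfl : j = -i := by omega
    obtain ⟨p, rfl⟩ : ∃ p, l = -p := ⟨-l, by omega⟩
    rw [pr_neg, pr_neg, ← h₁ k i (-i) rfl, ← h₁ i p (-p) rfl,
      Homotopy.comm_apply H p i k (by omega) hk x]
    dsimp only [η₁]
    rw [HomologicalComplex.XIsoOfEq_rfl, HomologicalComplex.XIsoOfEq_rfl]
    have rotate : ∀ a b c : R, a + b + c = c + a + b := fun _ _ _ => by ring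
    exact rotate _ _ _
  -- Average the homotopy with its flip. The flipped relation bounds the same difference, because
  -- `t` and `t'` are symmetric.
  refine ⟨fun i j => c • (η₀ i j + (η₀ j i).flip), fun i j x y => ?_, ?_⟩
  · change c * (η₀ i j x y + η₀ j i y x) = c * (η₀ j i y x + η₀ i j x y)
    rw [add_comm]
  · intro i j k l hk hl h x y
    change _ = _ + c * (η₀ k j _ y + η₀ j k y _) + c * (η₀ i l x _ + η₀ l i _ x)
    have e1 := h₀ i j k l hk hl h x y
    have e2 := h₀ j i l k hl hk (by omega) y x
    rw [isSelfDual_iff.1 ht j i (by omega) h, isSelfDual_iff.1 ht' j i (by omega) h] at e2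
    linear_combination c * e1 + c * e2 + (pr t' i j h x y - pr t i j h x y) * hc

/-- Since `θ` is an isomorphism its pairing is perfect, so a linear family of functionals is
represented by a linear map. The correcting homotopies are built this way. -/
theorem exists_pr_eq (θ : A ≅ dual A) (i j : ℤ) (h : i + j = 0) {M : ModuleCat.{u} R}
    (ℓ : M →ₗ[R] A.X j →ₗ[R] R) :
    ∃ κ : M ⟶ A.X i, ∀ x y, pr θ.hom i j h (κ.hom x) y = ℓ x y := by
  obtain rfl : j = -i := by omega
  refine ⟨ModuleCat.ofHom (show M →ₗ[R] (dual A).X i from ℓ) ≫ θ.inv.f i, fun x y => ?_⟩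
  rw [pr_neg]
  have h1 : θ.inv.f i ≫ θ.hom.f i = 𝟙 _ := congrArg (fun t => t.f i) θ.inv_hom_id
  exact congrArg (fun t => (show Module.Dual R (A.X (-i)) from t.hom (ℓ x)) y) h1

theorem IsSelfDual.ext {t t' : A ⟶ dual A} (ht : IsSelfDual t) (ht' : IsSelfDual t')
    (h : ∀ i j (hij : i + j = 0), i ≤ 0 → ∀ x y, pr t i j hij x y = pr t' i j hij x y) :
    t = t' := by
  refine pr_ext fun i j hij x y => ?_
  rcases le_total i 0 with hi | hi
  · exact h i j hij hi x y
  · rw [isSelfDual_iff.1 ht i j hij (by omega), isSelfDual_iff.1 ht' i j hij (by omega)]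
    exact h j i _ (by omega) y x

end Homotopies

/-! ### Making homotopic forms equal -/

section Correction

variable {R : Type u} [CommRing R] {A F E : Cplx R}

/-- As `f` is an isomorphism in negative degrees, `A⁰` is the module of cone cycles in `F⁰ ⊕ A¹`, a
direct summand. This allows functionals on `A⁰` to be extended when `f₀` is not invertible. -/
theorem exists_retraction_zero (hA : IsVectorBundleComplex A) (hF : IsVectorBundleComplex F)
    (f : A ⟶ F) [QuasiIso f] (hf : ∀ i ≤ -1, IsIso (f.f i)) :
    ∃ r : (F.X 0 × A.X 1) →ₗ[R] A.X 0, ∀ x, r ((f.f 0).hom x, (A.d 0 1).hom x) = x := by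
  obtain ⟨r, hr⟩ := exists_retraction_ker_coneD (coneExact_of_quasiIso f) hA hF 0 1 2 rfl rfl
  let ι : A.X 0 →ₗ[R] LinearMap.ker (coneD f 0 1 2) :=
    ((f.f 0).hom.prod (A.d 0 1).hom).codRestrict _ fun x =>
      (mem_ker_coneD f 0 1 2 _).2 ⟨comm_apply f 0 1 x, d_d_apply A 0 1 2 x⟩
  have hι : Function.Bijective ι := by
    constructor
    · intro x y hxy
      exact eq_of_p_eq_of_d_eq hf (congrArg (fun t => t.1.1) hxy) (congrArg (fun t => t.1.2) hxy)
    · rintro ⟨⟨b, s⟩, hx⟩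
      obtain ⟨h1, h2⟩ := (mem_ker_coneD f 0 1 2 _).1 hx
      obtain ⟨x, hx1, hx2⟩ := exists_of_d_eq_p hf b s h1 h2
      exact ⟨x, Subtype.ext (Prod.ext hx1 hx2)⟩
  refine ⟨(LinearEquiv.ofBijective ι hι).symm ∘ₗ r, fun x => ?_⟩
  have h := hr (ι x)
  exact (congrArg (LinearEquiv.ofBijective ι hι).symm h).trans
    ((LinearEquiv.ofBijective ι hι).symm_apply_apply x)

/-- If `f : A ⟶ F` is an isomorphism in negative degrees, `e : A ⟶ E` is an isomorphism in positive
degrees and the forms induced on `A` are homotopic, then `e` and `f` can be changed by homotopies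
such that the two forms agree. -/
theorem exists_homotopic_forms_eq {c : R} (hc : c * 2 = 1) (hA : IsVectorBundleComplex A)
    (hF : IsVectorBundleComplex F) (f : A ⟶ F) (e : A ⟶ E) [QuasiIso f]
    (hf : ∀ i ≤ -1, IsIso (f.f i)) (he : ∀ i : ℤ, 1 ≤ i → IsIso (e.f i))
    (θF : F ≅ dual F) (θE : E ≅ dual E) (hθF : IsSelfDual θF.hom) (hθE : IsSelfDual θE.hom)
    (H : Homotopy (e ≫ θE.hom ≫ dualMap e) (f ≫ θF.hom ≫ dualMap f)) :
    ∃ (f' : A ⟶ F) (e' : A ⟶ E), Nonempty (Homotopy f' f) ∧ Nonempty (Homotopy e' e) ∧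
      (∀ i ≤ -1, IsIso (f'.f i)) ∧ (∀ i : ℤ, 1 ≤ i → IsIso (e'.f i)) ∧
      e' ≫ θE.hom ≫ dualMap e' = f' ≫ θF.hom ≫ dualMap f' := by
  obtain ⟨η, hη, hηd⟩ := exists_symmetric_homotopy hc (hθE.pullback e) (hθF.pullback f) H
  obtain ⟨r, hr⟩ := exists_retraction_zero hA hF f hf
  -- The wish is `θ_F(κ y, f w) = η(y, w)`. Extending `η(y, ·)` through `r` and keeping the `F⁰`
  -- part achieves it up to the error `μ(y, d w)`, which comes from the `A¹` part.
  obtain ⟨κ, hκ⟩ := exists_pr_eq θF 0 0 (by norm_num)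
    ((η 1 0).compl₂ (r ∘ₗ LinearMap.inl R (F.X 0) (A.X 1)))
  let μ : A.X 1 →ₗ[R] A.X 1 →ₗ[R] R :=
    -((η 1 0).compl₂ (r ∘ₗ LinearMap.inr R (F.X 0) (A.X 1)))
  have hκ' : ∀ y w, pr θF.hom 0 0 (by norm_num) (κ.hom y) ((f.f 0).hom w) =
      η 1 0 y w + μ y ((A.d 0 1).hom w) := fun y w => by
    rw [hκ]
    change η 1 0 y (r ((f.f 0).hom w, 0)) = _ + -η 1 0 y (r (0, (A.d 0 1).hom w))
    rw [← sub_eq_add_neg, eq_sub_iff_add_eq, ← map_add, ← map_add, Prod.mk_add_mk, add_zero,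
      zero_add, hr]
  -- For `i ≥ 2` the complementary degree `l = 1 - i` is negative, so `f` is invertible there and no
  -- error arises.
  have key : ∀ i j : ℤ, ∃ k : A.X i ⟶ F.X j, (i ≤ 0 → k = 0) ∧ (2 ≤ i → j + 1 = i →
      ∀ l (h : j + l = 0) y w, pr θF.hom j l h (k.hom y) ((f.f l).hom w) = η i l y w) := by
    intro i j
    by_cases hij : 2 ≤ i ∧ j + 1 = i
    swap
    · exact ⟨0, fun _ => rfl, fun h h' => absurd ⟨h, h'⟩ hij⟩
    have := hf (-j) (by omega)
    obtain ⟨k, hk⟩ := exists_pr_eq θF j (-j) (by omega) ((η i (-j)).compl₂ (inv (f.f (-j))).hom)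
    refine ⟨k, fun _ => by omega, fun _ _ l h y w => ?_⟩
    obtain rfl : l = -j := by omega
    rw [hk]
    change η i (-j) y ((inv (f.f (-j))).hom ((f.f (-j)).hom w)) = _
    rw [hom_inv_apply]
  choose k₀ hk₀ hk₂ using key
  let k : ∀ i j : ℤ, A.X i ⟶ F.X j := Function.update k₀ 1 (Function.update (k₀ 1) 0 κ)
  have hk1 : k 1 0 = κ := by simp [k]
  have hk : ∀ i j, i ≠ 1 → k i j = k₀ i j := fun i j hi => by simp [k, Function.update_of_ne hi]
  have he1 := he 1 le_rfl
  -- In degree zero the corrected `F`-form is off by the symmetrization of `μ(d x, d y)` and by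
  -- `θ_F(κ d x, κ d y)`. The map `σ` puts these on the `E` side; the second term is halved because
  -- it occurs once from each argument.
  obtain ⟨σ, hσ⟩ := exists_pr_eq θE (-1) 1 (by norm_num)
    ((μ + c • (show A.X 1 →ₗ[R] A.X 1 →ₗ[R] R from LinearMap.mk₂ R
      (fun y z => pr θF.hom 0 0 (by norm_num) (κ.hom y) (κ.hom z))
      (fun _ _ _ => by rw [map_add, pr_add_left]) (fun _ _ _ => by rw [map_smul, pr_smul_left]; rfl)
      (fun _ _ _ => by rw [map_add, pr_add_right])
      (fun _ _ _ => by rw [map_smul, pr_smul_right]; rfl))).compl₂ (inv (e.f 1)).hom)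
  have hσ' : ∀ y z, pr θE.hom (-1) 1 (by norm_num) (σ.hom y) ((e.f 1).hom z) =
      μ y z + c * pr θF.hom 0 0 (by norm_num) (κ.hom y) (κ.hom z) := fun y z => by
    rw [hσ, LinearMap.compl₂_apply, hom_inv_apply]
    rfl
  -- With `d σ` as the only component, `e` changes in degree zero alone: the contribution in degree
  -- one is `d d σ = 0`.
  let k' : ∀ i j : ℤ, A.X i ⟶ E.X j :=
    Function.update (fun _ _ => 0) 1 (Function.update (fun _ => 0) 0 (σ ≫ E.d (-1) 0))
  have hk'1 : k' 1 0 = σ ≫ E.d (-1) 0 := by simp [k']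
  have hk' : ∀ i j, i ≠ 1 → k' i j = 0 := fun i j hi => by simp [k', Function.update_of_ne hi]
  obtain ⟨f', hf', hf'k⟩ := exists_homotopic f k
  obtain ⟨e', he', he'k⟩ := exists_homotopic e k'
  have hfneg : ∀ i ≤ -1, f'.f i = f.f i := fun i hi => by
    refine ModuleCat.hom_ext (LinearMap.ext fun x => ?_)
    rw [hf'k (i - 1) i (i + 1) (by omega) rfl, hk _ _ (by omega), hk _ _ (by omega),
      hk₀ _ _ (by omega), hk₀ _ _ (by omega)]
    change _ + 0 + (F.d (i - 1) i).hom 0 = _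
    rw [map_zero, add_zero, add_zero]
  have hfzero : ∀ x, (f'.f 0).hom x = (f.f 0).hom x + κ.hom ((A.d 0 1).hom x) := fun x => by
    rw [hf'k (-1) 0 1 rfl rfl, hk1, hk 0 _ (by norm_num), hk₀ _ _ le_rfl]
    change _ + _ + (F.d (-1) 0).hom 0 = _
    rw [map_zero, add_zero]
  have hene : ∀ i, i ≠ 0 → e'.f i = e.f i := fun i hi => by
    refine ModuleCat.hom_ext (LinearMap.ext fun x => ?_)
    rw [he'k (i - 1) i (i + 1) (by omega) rfl, hk' (i + 1) _ (by omega)]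
    change _ + 0 + _ = _
    rw [add_zero]
    rcases eq_or_ne i 1 with rfl | hi'
    · change _ + (E.d 0 1).hom ((k' 1 0).hom x) = _
      rw [hk'1]
      change _ + (E.d 0 1).hom ((E.d (-1) 0).hom _) = _
      rw [d_d_apply, add_zero]
    · rw [hk' i _ hi']
      change _ + (E.d (i - 1) i).hom 0 = _
      rw [map_zero, add_zero]
  have hezero : ∀ x, (e'.f 0).hom x =
      (e.f 0).hom x + (E.d (-1) 0).hom (σ.hom ((A.d 0 1).hom x)) := fun x => by
    rw [he'k (-1) 0 1 rfl rfl, hk'1, hk' 0 _ (by norm_num)]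
    change _ + _ + (E.d (-1) 0).hom 0 = _
    rw [map_zero, add_zero]
    rfl
  refine ⟨f', e', hf', he', fun i hi => ?_, fun i hi => ?_, ?_⟩
  · rw [hfneg i hi]
    exact hf i hi
  · rw [hene i (by omega)]
    exact he i hi
  -- By symmetry only `i ≤ 0` is needed. For `i < 0` the homotopy on `F` alone accounts for both `η`
  -- terms; in degree zero the two corrections balance.
  refine (hθE.pullback e').ext (hθF.pullback f') fun i j hij hi x y => ?_
  have hd := hηd i j (i + 1) (j + 1) rfl rfl hij x y
  rw [pr_comp, pr_comp] at hd ⊢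
  have symE := isSelfDual_iff.1 hθE
  have symF := isSelfDual_iff.1 hθF
  rcases eq_or_lt_of_le hi with rfl | hi
  · obtain rfl : j = 0 := by omega
    replace hd := hηd 0 0 1 1 rfl rfl hij x y
    rw [pr_comp, pr_comp] at hd
    rw [hfzero, hfzero, hezero, hezero]
    simp only [pr_add_left, pr_add_right]
    have e1 : pr θE.hom 0 0 hij ((E.d (-1) 0).hom (σ.hom ((A.d 0 1).hom x))) ((e.f 0).hom y) =
        _ := (pr_d θE.hom (-1) 0 0 1 rfl rfl hij _ _).trans
          ((congrArg _ (comm_apply e 0 1 y)).trans (hσ' _ _))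
    have e2 : pr θE.hom 0 0 hij ((E.d (-1) 0).hom (σ.hom ((A.d 0 1).hom y))) ((e.f 0).hom x) =
        _ := (pr_d θE.hom (-1) 0 0 1 rfl rfl hij _ _).trans
          ((congrArg _ (comm_apply e 0 1 x)).trans (hσ' _ _))
    have e3 : pr θE.hom 0 0 hij ((E.d (-1) 0).hom (σ.hom ((A.d 0 1).hom x)))
        ((E.d (-1) 0).hom (σ.hom ((A.d 0 1).hom y))) = 0 := by
      rw [pr_d θE.hom (-1) 0 0 1 rfl rfl hij, d_d_apply, pr_zero_right]
    have e4 := hκ' ((A.d 0 1).hom x) y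
    have e5 := hκ' ((A.d 0 1).hom y) x
    rw [symE 0 0 hij hij ((e.f 0).hom x) ((E.d (-1) 0).hom _), e1, e2, e3,
      symF 0 0 hij hij ((f.f 0).hom x) (κ.hom _), e4, e5, hd,
      symF 0 0 hij hij (κ.hom ((A.d 0 1).hom y))]
    rw [hη 0 1]
    linear_combination (pr θF.hom 0 0 hij (κ.hom ((A.d 0 1).hom x))
      (κ.hom ((A.d 0 1).hom y))) * hc
  · rw [hene i (by omega), hene j (by omega), hfneg i (by omega),
      hf'k (j - 1) j (j + 1) (by omega) rfl, pr_add_right, pr_add_right, hd]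
    have e1 : pr θF.hom i j hij ((f.f i).hom x) ((k (j + 1) j).hom ((A.d j (j + 1)).hom y)) =
        η i (j + 1) x ((A.d j (j + 1)).hom y) := by
      rw [hk _ _ (by omega), symF i j hij (by omega), hk₂ _ _ (by omega) rfl, hη]
    have e2 : pr θF.hom i j hij ((f.f i).hom x) ((F.d (j - 1) j).hom ((k j (j - 1)).hom y)) =
        η (i + 1) j ((A.d i (i + 1)).hom x) y := by
      rw [← pr_d θF.hom i (i + 1) (j - 1) j rfl (by omega) (by omega), comm_apply,
        symF _ _ _ (by omega)]
      rcases eq_or_ne j 1 with rfl | hj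
      · obtain rfl : i = -1 := by omega
        change pr θF.hom 0 0 _ ((k 1 0).hom y) ((f.f 0).hom ((A.d (-1) 0).hom x)) =
          η 0 1 ((A.d (-1) 0).hom x) y
        rw [hk1, hκ', d_d_apply, map_zero, add_zero, hη]
      · rw [hk _ _ hj, hk₂ _ _ (by omega) (by omega), hη]
    rw [e1, e2]
    ring

end Correction

/-! ### Any two representatives are directly related -/

section Comparison

variable {R : Type u} [CommRing R] [HasDerivedCategory.{w} (ModuleCat.{u} R)]

open DerivedCategory

/-- Any two self-dual representatives are related by a generalized isotropic reduction. -/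
theorem nonempty_genIsotropicReduction (h2 : IsUnit (2 : R)) {E : QuadraticComplex.{w} R}
    (F G : SelfDualRep E) : Nonempty (GenIsotropicReduction F G) := by
  obtain ⟨c, hc⟩ := h2.exists_left_inv
  have hF := F.str.isVB
  have hG := G.str.isVB
  obtain ⟨ψ, hψ⟩ := exists_lift hG (G.str.α.hom ≫ F.str.α.inv)
  have hψ' : Q.map ψ ≫ F.str.α.hom = G.str.α.hom := by rw [hψ]; simp
  have : QuasiIso ψ := (quasiIso_iff_isIso_Q_map ψ).2 (by rw [hψ]; infer_instance)
  have := quasiIso_etaMinus ψ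
  have := quasiIso_etaPlus ψ
  have hA := hG.splice (f := ψ) hF
  -- The map `η⁻` points from `G` to the spliced complex; a leg to `G` needs the reverse direction,
  -- still invertible in positive degrees.
  obtain ⟨e, hme, he⟩ := exists_homotopy_inverse hA (etaMinus ψ) (isIso_etaMinus_f ψ)
  have := (quasiIso_iff_isIso_Q_map (etaMinus ψ)).1 inferInstance
  have := (quasiIso_iff_isIso_Q_map (etaPlus ψ)).1 inferInstance
  have hcomp : Q.map e ≫ G.str.α.hom = Q.map (etaPlus ψ) ≫ F.str.α.hom := by
    rw [← cancel_epi (Q.map (etaMinus ψ)), reassoc_of% hme, ← hψ', ← Category.assoc,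
      ← Functor.map_comp, etaMinus_comp_etaPlus]
  let β : Q.obj (splice ψ) ≅ E.obj := asIso (Q.map (etaPlus ψ)) ≪≫ F.str.α
  have h1 := (represents_pullback_iff E hF hA (etaPlus ψ) F.str.α β rfl F.str.θ.hom).2
    F.str.represents
  have h3 := (represents_pullback_iff E hG hA e G.str.α β hcomp G.str.θ.hom).2
    G.str.represents
  -- Both pulled-back forms represent the form of `E` under the same identification, so they agree
  -- in the derived category.
  obtain ⟨H⟩ := homotopy_of_map_eq hA (h3.symm.trans h1)
  obtain ⟨f', e', ⟨Hf⟩, ⟨He⟩, hf', he', hforms⟩ := exists_homotopic_forms_eq hc hA hF (etaPlus ψ) e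
    (isIso_etaPlus_f ψ) he F.str.θ G.str.θ F.str.self_dual G.str.self_dual H
  have hQf := map_eq_of_homotopy Hf
  have hQe := map_eq_of_homotopy He
  refine ⟨{
    A := splice ψ
    isVB := hA
    g := e'
    f := f'
    quasiIso_g := ?_
    quasiIso_f := ?_
    compatible := by rw [hQf, hQe, hcomp]
    isIso_g := he'
    isIso_f := hf'
    forms := hforms }⟩
  · rw [quasiIso_iff_isIso_Q_map, hQe, IsIso.eq_inv_of_hom_inv_id hme]
    infer_instance
  · rw [quasiIso_iff_isIso_Q_map, hQf]
    infer_instance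

end Comparison

end QuadCplx

theorem mainTheorem10 {R : Type u} [CommRing R] [HasDerivedCategory.{w} (ModuleCat.{u} R)]
    (h2 : IsUnit (2 : R)) (E : QuadCplx.QuadraticComplex.{w} R) :
    -- the quadratic complex is represented by a self-dual map `t : A ⟶ Aᵛ` of complexes
    (∃ (A : QuadCplx.Cplx R) (hA : QuadCplx.IsVectorBundleComplex A) (t : A ⟶ QuadCplx.dual A)
      (β : DerivedCategory.Q.obj A ≅ E.obj),
      QuadCplx.IsSelfDual t ∧ QuadCplx.Represents E hA t β) ∧
    -- splicing any such map gives a self-dual representative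
    (∀ (A : QuadCplx.Cplx R) (hA : QuadCplx.IsVectorBundleComplex A) (t : A ⟶ QuadCplx.dual A)
      (β : DerivedCategory.Q.obj A ≅ E.obj),
      QuadCplx.IsSelfDual t → QuadCplx.Represents E hA t β →
      ∃ S : QuadCplx.SelfDualRepStructure E (QuadCplx.splice t),
        DerivedCategory.Q.map (QuadCplx.etaMinus t) ≫ S.α.hom = β.hom ∧
        S.θ.hom ≫ QuadCplx.dualMap (QuadCplx.etaMinus t) = QuadCplx.etaPlus t) ∧
    -- in particular self-dual representatives exist
    Nonempty (QuadCplx.SelfDualRep E) ∧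
    -- a generalized isotropic reduction from `F` to `G` can be upgraded
    (∀ F G : QuadCplx.SelfDualRep E, Nonempty (QuadCplx.GenIsotropicReduction F G) →
      ∃ F' : QuadCplx.SelfDualRep E,
        Nonempty (QuadCplx.IsotropicReduction F' F) ∧
        Nonempty (QuadCplx.IsotropicReduction F' G)) ∧
    -- any two representatives have a common generalized reduction `G`, and they are connected
    -- by genuine isotropic reductions through `F₁'`, `G` and `F₂'`
    (∀ F₁ F₂ : QuadCplx.SelfDualRep E, ∃ G : QuadCplx.SelfDualRep E,
      Nonempty (QuadCplx.GenIsotropicReduction F₁ G) ∧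
      Nonempty (QuadCplx.GenIsotropicReduction F₂ G) ∧
      ∃ F₁' F₂' : QuadCplx.SelfDualRep E,
        Nonempty (QuadCplx.IsotropicReduction F₁' F₁) ∧
        Nonempty (QuadCplx.IsotropicReduction F₁' G) ∧
        Nonempty (QuadCplx.IsotropicReduction F₂' G) ∧
        Nonempty (QuadCplx.IsotropicReduction F₂' F₂)) := by
  have key := fun F G : QuadCplx.SelfDualRep E =>
    QuadCplx.nonempty_genIsotropicReduction h2 F G
  obtain ⟨A, hA, t, β, ht, hβ⟩ := QuadCplx.exists_selfDual_represents h2 E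
  obtain ⟨S, -, -⟩ := QuadCplx.exists_selfDualRepStructure_splice E A hA t β ht hβ
  refine ⟨⟨A, hA, t, β, ht, hβ⟩, QuadCplx.exists_selfDualRepStructure_splice E,
    ⟨⟨_, S⟩⟩, fun F G ⟨ρ⟩ => QuadCplx.exists_isotropicReductions ρ, fun F₁ F₂ => ?_⟩
  -- Since `F₁` is directly related to `F₂`, the common reduction can be `F₂` itself.
  obtain ⟨ρ₁⟩ := key F₁ F₂
  obtain ⟨ρ₂⟩ := key F₂ F₂
  obtain ⟨F₁', h₁, h₁'⟩ := QuadCplx.exists_isotropicReductions ρ₁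
  obtain ⟨F₂', h₂, h₂'⟩ := QuadCplx.exists_isotropicReductions ρ₂
  exact ⟨F₂, ⟨ρ₁⟩, ⟨ρ₂⟩, F₁', F₂', h₁, h₁', h₂', h₂⟩
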